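/- Let $n\in\{2,3\}$, $q\in\mathbb N_0$, $\sigma,\Lambda\in\mathbb R$. There is a constant $C>0$, depending only on $n,q,\sigma,\Lambda$, such that the following holds. **Meshes.** Let $\Omega\subset\mathbb R^n$ be an open set with $\Omega=\mathrm{int}\,\overline\Omega$ (e.g. a bounded Lipschitz domain), and let $\mathcal T_H$ be a finite conforming triangulation of it into open nondegenerate simplices with ordered vertices, $\overline\Omega=\bigcup_{T\in\mathcal T_H}\overline T$, which is shape regular: each $\overline T$ contains a ball of radius $\rho_T>0$ with $H_T:=\operatorname{diam}T\le\sigma\rho_T$. Let $m\ge 0$ and let $\mathcal S^m(\mathcal T_H)$ be the mesh obtained by subdividing each $T$ uniformly $m$ times (red refinement for $n=2$, Bey's refinement for $n=3$). Let $T_m$ be the set of points of $\overline T$ whose barycentric coordinates are multiples of $2^{-m}$, $\mathring T_m=T_m\cap T$, $\partial T_m=T_m\setminus\mathring T_m$, $\mathbb X_m=\bigcup_T T_m=\{x_i\}$, $\partial\mathbb X_m=\bigcup_T\partial T_m$. Let $\phi_i$ be the continuous, piecewise affine vertex function of $x_i$ on $\mathcal S^m(\mathcal T_H)$. Put $H=\max_T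 H_T$, $h_T=2^{-m}H_T$, $h=2^{-m}H$. **True matrix.** For a tensor $K:\Omega\to\mathbb R^{n\times n}$ with entries in $L^\infty(\Omega)$ let $\mathsf A_{ij}=\int_\Omega\nabla\phi_j^\top K\,\nabla\phi_i\,dx$ for all $x_i,x_j\in\mathbb X_m$. **Stencil functions.** Write $\operatorname{supp}u=\{u\ne0\}$. Let $\mathscr D(\mathring T_m)$ be the set of all $\delta=x_j-x_i$ with $x_i\in\mathring T_m$, $x_j\in\mathbb X_m$ and $\operatorname{supp}\phi_i\cap\operatorname{supp}\phi_j\neq\emptyset$. For each $T$ with $\mathring T_m\ne\emptyset$ fix any $x_k\in\mathring T_m$ and put $\phi(y)=\phi_k(y+x_k)$. For $\delta\in\mathscr D(\mathring T_m)$ put $\phi_\delta(y)=\phi(y-\delta)$, $\Omega_\delta=\operatorname{supp}\phi\cap\operatorname{supp}\phi_\delta$, $T_\delta=\{x\in T: x+y\in T\ \forall y\in\Omega_\delta\}$ and $$\Phi_T^\delta(x)=\int_{\Omega_\delta}\nabla\phi_\delta(y)^\top K(x+y)\nabla\phi(y)\,dy,\qquad x\in\overline{T_\delta}.$$ Let $\Pi_T^\delta:C^0(\overline{T_\delta})\to\mathcal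 P_q(T_\delta)$ be a linear projection onto the (restrictions of) polynomials of total degree at most $q$ with $\|\Pi^\delta_Tf\|_{L^\infty}\le\Lambda\|f\|_{L^\infty}$. **Surrogate matrix.** Define $$\tilde{\mathsf A}_{ij}=\begin{cases}\mathsf A_{ij}&\text{if } x_i,x_j\in\partial\mathbb X_m,\\ (\Pi_T^\delta\Phi_T^\delta)(x_i)&\text{if }\delta=x_j-x_i\in\mathscr D(\mathring T_m)\text{ and } x_i\in\mathring T_m\text{ or }x_j\in\mathring T_m,\ T\in\mathcal T_H,\\0&\text{otherwise.}\end{cases}$$ **Claim.** Let $0\le r\le q$ be an integer, and let $|K|_{W^{r+1,\infty}(T)}$ denote the maximum of $\|\partial^\alpha K_{ab}\|_{L^\infty(T)}$ over $a,b$ and $|\alpha|=r+1$. (a) If $T\in\mathcal T_H$ and $K_{ab}|_T\in W^{r+1,\infty}(T)$ for all $a,b$, then $$\max_{x_i,x_j\in T_m}|\mathsf A_{ij}-\tilde{\mathsf A}_{ij}|\le C\,h_T^{n-2}H_T^{r+1}|K|_{W^{r+1,\infty}(T)}.$$ (b) If $K_{ab}|_T\in W^{r+1,\infty}(T)$ for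 all $a,b$ and all $T\in\mathcal T_H$, then $$\max_{i,j}|\mathsf A_{ij}-\tilde{\mathsf A}_{ij}|\le C\,h^{n-2}H^{r+1}\max_{T\in\mathcal T_H}|K|_{W^{r+1,\infty}(T)}.$$ -/

import Mathlib

open Set MeasureTheory
open scoped ContDiff

noncomputable section

namespace SurrogateFEM

/-- Euclidean space of dimension `n`. -/
abbrev E (n : ℕ) := EuclideanSpace ℝ (Fin n)

/-! ### Sobolev spaces of essentially bounded functions -/

/-- The iterated partial derivative along the coordinate directions `s 0, …, s (k - 1)`.
The index sequences of length `k` enumerate (with repetition) the multi-indices of order `k`. -/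
def partialDeriv {n k : ℕ} (s : Fin k → Fin n) (f : E n → ℝ) (x : E n) : ℝ :=
  iteratedFDeriv ℝ k f x (fun l => EuclideanSpace.single (s l) (1 : ℝ))

/-- `g` is the weak derivative of `v` on the open set `U` along the directions `s`. -/
def IsWeakDeriv {n k : ℕ} (U : Set (E n)) (s : Fin k → Fin n) (v g : E n → ℝ) : Prop :=
  LocallyIntegrableOn v U volume ∧ LocallyIntegrableOn g U volume ∧
    ∀ η : E n → ℝ, ContDiff ℝ ∞ η → HasCompactSupport η → tsupport η ⊆ U →
      ∫ x in U, v x * partialDeriv s η x = (-1 : ℝ) ^ k * ∫ x in U, g x * η x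

/-- Membership in `W^{k,∞}(U)`. -/
def MemSobolev {n : ℕ} (k : ℕ) (U : Set (E n)) (v : E n → ℝ) : Prop :=
  MemLp v ⊤ (volume.restrict U) ∧
    ∀ j ≤ k, ∀ s : Fin j → Fin n, ∃ g, IsWeakDeriv U s v g ∧ MemLp g ⊤ (volume.restrict U)

open Classical in
/-- The weak derivative of `v` along `s` (unique almost everywhere on `U`; zero if there is none). -/
def weakDeriv {n k : ℕ} (U : Set (E n)) (s : Fin k → Fin n) (v : E n → ℝ) : E n → ℝ :=
  if h : ∃ g, IsWeakDeriv U s v g then h.choose else 0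

/-- The seminorm `|v|_{W^{k,∞}(U)}`: the largest `L^∞(U)` norm of a weak derivative of order `k`. -/
def sobolevSeminorm {n : ℕ} (k : ℕ) (U : Set (E n)) (v : E n → ℝ) : ℝ :=
  ⨆ s : Fin k → Fin n, (eLpNorm (weakDeriv U s v) ⊤ (volume.restrict U)).toReal

/-- The seminorm of a matrix field: the maximum over its entries. -/
def tensorSeminorm {n : ℕ} (k : ℕ) (U : Set (E n)) (K : E n → Matrix (Fin n) (Fin n) ℝ) : ℝ :=
  ⨆ a : Fin n, ⨆ b : Fin n, sobolevSeminorm k U (fun x => K x a b)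

/-! ### Macro-meshes and their uniform refinements -/

/-- A macro-element: a nondegenerate simplex with a fixed order of its vertices.
The open simplex is `T.interior`, the closed one is `T.closedInterior`. -/
abbrev Macro (n : ℕ) := Affine.Simplex ℝ (E n) n

/-- `Th` is a conforming simplicial triangulation of `Ω`. The first field holds for every Lipschitz
domain: it says that `Ω` is the interior of its closure. -/
structure IsMacroMesh {n : ℕ} (Ω : Set (E n)) (Th : Set (Macro n)) : Prop where
  regular : interior (closure Ω) = Ω
  finite : Th.Finite
  cover : closure Ω = ⋃ T ∈ Th, T.closedInterior
  disjoint : ∀ T ∈ Th, ∀ T' ∈ Th, T ≠ T' → Disjoint T.interior T'.interior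
  conforming : ∀ T ∈ Th, ∀ T' ∈ Th,
    T.closedInterior ∩ T'.closedInterior = convexHull ℝ (range T.points ∩ range T'.points)

/-- The diameter `H_T`. -/
def elemDiam {n : ℕ} (T : Macro n) : ℝ := Metric.diam T.closedInterior

/-- The mesh size `H = max_T H_T`. -/
def meshSize {n : ℕ} (Th : Set (Macro n)) : ℝ := ⨆ T : Th, elemDiam T.1

/-- Shape regularity with parameter `σ`: every element contains a ball whose radius `ρ` satisfies
`H_T ≤ σ ρ`. -/
def ShapeRegular {n : ℕ} (σ : ℝ) (Th : Set (Macro n)) : Prop :=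
  ∀ T ∈ Th, ∃ (z : E n) (ρ : ℝ), 0 < ρ ∧ Metric.closedBall z ρ ⊆ T.closedInterior ∧
    elemDiam T ≤ σ * ρ

/-- The subdivision of a triangle or tetrahedron into `2 ^ n` simplices of equal volume through
the midpoints of its edges: red refinement for `n = 2`, Bey's refinement for `n = 3`.
(Other dimensions are not used.) -/
def subdivide : {n : ℕ} → (Fin (n + 1) → E n) → Set (Fin (n + 1) → E n)
  | 2, y =>
    let m := fun i j => midpoint ℝ (y i) (y j)
    {![y 0, m 0 1, m 0 2], ![m 0 1, y 1, m 1 2], ![m 0 2, m 1 2, y 2], ![m 0 1, m 1 2, m 0 2]}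
  | 3, y =>
    let m := fun i j => midpoint ℝ (y i) (y j)
    {![y 0, m 0 1, m 0 2, m 0 3], ![m 0 1, y 1, m 1 2, m 1 3],
      ![m 0 2, m 1 2, y 2, m 2 3], ![m 0 3, m 1 3, m 2 3, y 3],
      ![m 0 1, m 0 2, m 0 3, m 1 3], ![m 0 1, m 0 2, m 1 2, m 1 3],
      ![m 0 2, m 0 3, m 1 3, m 2 3], ![m 0 2, m 1 2, m 1 3, m 2 3]}
  | _, y => {y}

/-- The `m`-fold subdivision of a simplex. -/
def refine {n : ℕ} : ℕ → (Fin (n + 1) → E n) → Set (Fin (n + 1) → E n)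
  | 0, y => {y}
  | m + 1, y => ⋃ t ∈ refine m y, subdivide t

/-- The locally-structured mesh of level `m`. -/
def fineMesh {n : ℕ} (Th : Set (Macro n)) (m : ℕ) : Set (Fin (n + 1) → E n) :=
  ⋃ T ∈ Th, refine m T.points

/-- The simplicial lattice `T_m`: the affine image of the points of `2^{-m} ℤ^n` in the closed
reference simplex, i.e. the points of `T` whose barycentric coordinates are multiples
of `2^{-m}`. -/
def lattice {n : ℕ} (m : ℕ) (T : Macro n) : Set (E n) :=
  {x | ∃ k : Fin (n + 1) → ℕ, ∑ i, k i = 2 ^ m ∧ x = ∑ i, ((k i : ℝ) / 2 ^ m) • T.points i}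

/-- The lattice points in the open simplex. -/
def latticeInterior {n : ℕ} (m : ℕ) (T : Macro n) : Set (E n) := lattice m T ∩ T.interior

/-- The lattice points on the boundary of the simplex. -/
def latticeBoundary {n : ℕ} (m : ℕ) (T : Macro n) : Set (E n) :=
  lattice m T \ latticeInterior m T

/-- All vertices of level `m`. -/
def vertices {n : ℕ} (Th : Set (Macro n)) (m : ℕ) : Set (E n) := ⋃ T ∈ Th, lattice m T

/-- All macro-mesh boundary vertices of level `m`. -/
def boundaryVertices {n : ℕ} (Th : Set (Macro n)) (m : ℕ) : Set (E n) :=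
  ⋃ T ∈ Th, latticeBoundary m T

/-- The vertex function of `z` on a conforming simplicial mesh `S`: at a point `x` with barycentric
coordinates `w` in a simplex `t` of `S` its value is the sum of the `w k` with `t k = z`, that is,
the value at `x` of the affine interpolant on `t` of the nodal values `1` at `z` and `0` elsewhere.
(By conformity this does not depend on `t`; the function is extended by zero outside the mesh.) -/
def vertexFn {n : ℕ} (S : Set (Fin (n + 1) → E n)) (z x : E n) : ℝ :=
  sSup {c | ∃ t ∈ S, ∃ w ∈ stdSimplex ℝ (Fin (n + 1)), ∑ k, w k • t k = x ∧
    c = ∑ k, w k * indicator {z} (fun _ => (1 : ℝ)) (t k)}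

/-! ### The true stiffness matrix -/

/-- The integrand `∇u^⊤ K ∇v` of the bilinear form, with a given value `M` of `K`. -/
def flux {n : ℕ} (M : Matrix (Fin n) (Fin n) ℝ) (p r : E n) : ℝ :=
  ∑ a, ∑ b, p a * M a b * r b

/-- The bilinear form `a(u, v) = ∫_Ω ∇u^⊤ K ∇v`, for piecewise smooth Lipschitz functions. -/
def bilinForm {n : ℕ} (Ω : Set (E n)) (K : E n → Matrix (Fin n) (Fin n) ℝ) (u v : E n → ℝ) : ℝ :=
  ∫ x in Ω, flux (K x) (gradient u x) (gradient v x)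

/-- The true stiffness matrix, `A_{ij} = a(φ_j, φ_i)`. -/
def trueMatrix {n : ℕ} (Ω : Set (E n)) (Th : Set (Macro n)) (m : ℕ)
    (K : E n → Matrix (Fin n) (Fin n) ℝ) : Matrix (vertices Th m) (vertices Th m) ℝ :=
  fun i j => bilinForm Ω K (vertexFn (fineMesh Th m) j) (vertexFn (fineMesh Th m) i)

/-! ### Stencil functions -/

/-- The set `𝒟(T̊_m)` of translations from an interior lattice point of `T` to a vertex such that the
two vertex functions have overlapping supports. -/
def translations {n : ℕ} (Th : Set (Macro n)) (m : ℕ) (T : Macro n) : Set (E n) :=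
  {δ | ∃ x ∈ latticeInterior m T, ∃ x' ∈ vertices Th m, δ = x' - x ∧
    (Function.support (vertexFn (fineMesh Th m) x) ∩
      Function.support (vertexFn (fineMesh Th m) x')).Nonempty}

/-- The test function `φ(y) = φ_c(y + c)` centred at the origin. -/
def testFn {n : ℕ} (Th : Set (Macro n)) (m : ℕ) (c : E n) (y : E n) : ℝ :=
  vertexFn (fineMesh Th m) c (y + c)

/-- The translated function `φ_δ(y) = φ(y - δ)`. -/
def shift {n : ℕ} (φ : E n → ℝ) (δ y : E n) : ℝ := φ (y - δ)

/-- `Ω_δ = supp φ ∩ supp φ_δ`, where `supp` is the set of points at which a function is nonzero. -/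
def overlap {n : ℕ} (φ : E n → ℝ) (δ : E n) : Set (E n) :=
  Function.support φ ∩ Function.support (shift φ δ)

/-- The stencil function `Φ^δ(x) = ∫_{Ω_δ} ∇φ_δ(y)^⊤ K(x + y) ∇φ(y) dy`. -/
def stencilFn {n : ℕ} (K : E n → Matrix (Fin n) (Fin n) ℝ) (φ : E n → ℝ) (δ x : E n) : ℝ :=
  ∫ y in overlap φ δ, flux (K (x + y)) (gradient (shift φ δ) y) (gradient φ y)

/-- The closure of `T_δ = {x ∈ T : x + y ∈ T for all y ∈ Ω_δ}`. -/
def stencilDomain {n : ℕ} (T : Macro n) (φ : E n → ℝ) (δ : E n) : Set (E n) :=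
  closure {x | x ∈ T.interior ∧ ∀ y ∈ overlap φ δ, x + y ∈ T.interior}

/-- `f` is the restriction to `S` of a polynomial of total degree at most `q`. -/
def IsPolyOn {n : ℕ} (q : ℕ) {S : Set (E n)} (f : C(S, ℝ)) : Prop :=
  ∃ p : MvPolynomial (Fin n) ℝ, p.totalDegree ≤ q ∧
    ∀ x : S, f x = MvPolynomial.eval (fun a => x.1 a) p

/-- `P` is a linear projection of `C⁰(S)` onto the polynomials of degree at most `q`, continuous in
the maximum norm with constant `Λ`. -/
structure IsPolyProjection {n : ℕ} (q : ℕ) (Λ : ℝ) {S : Set (E n)}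
    (P : C(S, ℝ) →ₗ[ℝ] C(S, ℝ)) : Prop where
  mem : ∀ f, IsPolyOn q (P f)
  fix : ∀ f, IsPolyOn q f → P f = f
  bound : ∀ (f : C(S, ℝ)) (M : ℝ), (∀ x, |f x| ≤ M) → ∀ x, |P f x| ≤ Λ * M

open Classical in
/-- The projected function `P f` for a function `f` that is continuous on `S`, as a function
on `S` extended by zero. -/
def project {n : ℕ} {S : Set (E n)} (P : C(S, ℝ) →ₗ[ℝ] C(S, ℝ)) (f : E n → ℝ) (x : E n) : ℝ :=
  if hf : ContinuousOn f S then
    if hx : x ∈ S then P ⟨S.domRestrict f, hf.domRestrict⟩ ⟨x, hx⟩ else 0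
  else 0

/-- A choice of operators `Π^δ_T` on `C⁰` of the closure of `T_δ`, where the stencil of `T` is taken
from the interior lattice point `c T`. -/
abbrev ProjectionFamily {n : ℕ} (Th : Set (Macro n)) (m : ℕ) (c : Macro n → E n) :=
  ∀ (T : Macro n) (δ : E n),
    C(stencilDomain T (testFn Th m (c T)) δ, ℝ) →ₗ[ℝ] C(stencilDomain T (testFn Th m (c T)) δ, ℝ)

/-- The surrogate stencil function `Π^δ_T Φ^δ_T`. -/
def surrogateStencilFn {n : ℕ} (Th : Set (Macro n)) (m : ℕ)
    (K : E n → Matrix (Fin n) (Fin n) ℝ) (c : Macro n → E n) (P : ProjectionFamily Th m c)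
    (T : Macro n) (δ x : E n) : ℝ :=
  project (P T δ) (stencilFn K (testFn Th m (c T)) δ) x

/-! ### The surrogate stiffness matrix -/

open Classical in
/-- The surrogate stiffness matrix: exact entries for pairs of macro-mesh boundary vertices,
surrogate stencil values `(Π^δ_T Φ^δ_T)(x_i)` if `δ = x_j - x_i ∈ 𝒟(T̊_m)` and `x_i` or `x_j` lies in
`T̊_m` (there is at most one such `T`), and zero otherwise. -/
def surrogateMatrix {n : ℕ} (Ω : Set (E n)) (Th : Set (Macro n)) (m : ℕ)
    (K : E n → Matrix (Fin n) (Fin n) ℝ) (c : Macro n → E n) (P : ProjectionFamily Th m c) :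
    Matrix (vertices Th m) (vertices Th m) ℝ :=
  fun i j =>
    if i.1 ∈ boundaryVertices Th m ∧ j.1 ∈ boundaryVertices Th m then
      trueMatrix Ω Th m K i j
    else if h : ∃ T ∈ Th, j.1 - i.1 ∈ translations Th m T ∧
        (i.1 ∈ latticeInterior m T ∨ j.1 ∈ latticeInterior m T) then
      surrogateStencilFn Th m K c P h.choose (j.1 - i.1) i.1
    else 0

/-- The maximum of `|M_{ij}|` over the (finitely many) vertices `i`, `j` in the set `S`. -/
def maxNormOn {n : ℕ} {V : Set (E n)} (S : Set (E n)) (M : Matrix V V ℝ) : ℝ :=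
  sSup {c | ∃ i j : V, i.1 ∈ S ∧ j.1 ∈ S ∧ c = |M i j|}

/-- The norm `‖M‖_max`. -/
def maxNorm {n : ℕ} {V : Set (E n)} (M : Matrix V V ℝ) : ℝ := maxNormOn V M

end SurrogateFEM

end

/-!
For `n = 2, 3` the uniform refinement of a simplex `T` is the Kuhn triangulation in the barycentric
coordinates of `T`. Hence, inside `T`, all vertex functions are translates of the one hat function
`max 0 (1 - 2 ^ m * p)`, where the seminorm `p` is the largest of finitely many functionals whose
level sets at multiples of `2⁻ᵐ` carry the walls of the refinement. A matrix entry with a vertex in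
the interior of `T` is therefore a value of the stencil function `Φ_T^δ`.

The stencil function is a sum of correlations of the entries of `K` with compactly supported weights
whose `L¹` norms are of order `h_T ^ (n - 2)`. Correlation with a weight preserves polynomials of
degree at most `r`. Approximating the entries of `K` up to order `H_T ^ (r + 1) |K|` by limits of
Taylor polynomials of mollifications thus yields a polynomial approximating `Φ_T^δ`, and a bounded
projection onto polynomials is at most a factor `1 + Λ` worse than the best approximation.
-/

noncomputable section

namespace SurrogateFEM

open scoped Convolution NNReal

variable {n : ℕ}

/-! ### Uniform refinement -/

/-- The combinatorics of `subdivide` for `n = 2, 3`: the `k`-th vertex of the child `e` is the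
midpoint of the vertices `(e k).1` and `(e k).2` of its parent. -/
def childEdges : (n : ℕ) → Set (Fin (n + 1) → Fin (n + 1) × Fin (n + 1))
  | 2 => {![(0, 0), (0, 1), (0, 2)], ![(0, 1), (1, 1), (1, 2)], ![(0, 2), (1, 2), (2, 2)],
      ![(0, 1), (1, 2), (0, 2)]}
  | 3 => {![(0, 0), (0, 1), (0, 2), (0, 3)], ![(0, 1), (1, 1), (1, 2), (1, 3)],
      ![(0, 2), (1, 2), (2, 2), (2, 3)], ![(0, 3), (1, 3), (2, 3), (3, 3)],
      ![(0, 1), (0, 2), (0, 3), (1, 3)], ![(0, 1), (0, 2), (1, 2), (1, 3)],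
      ![(0, 2), (0, 3), (1, 3), (2, 3)], ![(0, 2), (1, 2), (1, 3), (2, 3)]}
  | _ => {fun k => (k, k)}

lemma subdivide_eq_image_childEdges (y : Fin (n + 1) → E n) :
    subdivide y = (fun e k => midpoint ℝ (y (e k).1) (y (e k).2)) '' childEdges n := by
  match n, y with
  | 2, y | 3, y =>
    simp only [subdivide, childEdges, image_insert_eq, image_singleton]
    congr! <;> rename_i k <;> fin_cases k <;> simp
  | 0, y | 1, y | k + 4, y => simp [subdivide, childEdges]

lemma mem_subdivide_iff {y t : Fin (n + 1) → E n} : t ∈ subdivide y ↔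
    ∃ e ∈ childEdges n, (fun k => midpoint ℝ (y (e k).1) (y (e k).2)) = t := by
  rw [subdivide_eq_image_childEdges, mem_image]

/-- Integer vertex labels of an ordered simplex that differ by at most one and do not alternate
along the order of the vertices; red and Bey refinement preserve this property. -/
def IsKuhnLabelling (z : Fin (n + 1) → ℤ) : Prop :=
  (∀ i j, z i ≤ z j + 1) ∧
    ∀ i j k l, i < j → j < k → k < l → z i = z k → z j = z l → z i = z j

lemma isKuhnLabelling_two_iff {z : Fin 3 → ℤ} :
    IsKuhnLabelling z ↔ ∀ i j, z i ≤ z j + 1 :=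
  ⟨fun h => h.1, fun h => ⟨h, by omega⟩⟩

lemma isKuhnLabelling_three_iff {z : Fin 4 → ℤ} :
    IsKuhnLabelling z ↔ (∀ i j, z i ≤ z j + 1) ∧ (z 0 = z 2 → z 1 = z 3 → z 0 = z 1) := by
  refine ⟨fun h => ⟨h.1, h.2 0 1 2 3 (by decide) (by decide) (by decide)⟩, fun h => ⟨h.1, ?_⟩⟩
  intro i j k l hij hjk hkl
  obtain ⟨rfl, rfl, rfl, rfl⟩ : i = 0 ∧ j = 1 ∧ k = 2 ∧ l = 3 := by
    revert i j k l; decide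
  exact h.2

lemma IsKuhnLabelling.child (hn : n = 2 ∨ n = 3) {z : Fin (n + 1) → ℤ} (hz : IsKuhnLabelling z)
    {e : Fin (n + 1) → Fin (n + 1) × Fin (n + 1)} (he : e ∈ childEdges n) :
    IsKuhnLabelling fun k => z (e k).1 + z (e k).2 := by
  rcases hn with rfl | rfl
  · rw [isKuhnLabelling_two_iff] at hz ⊢
    simp only [Fin.forall_fin_succ, Fin.isValue] at hz ⊢
    rcases he with rfl | rfl | rfl | rfl <;> simp at hz ⊢ <;> omega
  · rw [isKuhnLabelling_three_iff] at hz ⊢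
    simp only [Fin.forall_fin_succ, Fin.isValue] at hz ⊢
    rcases he with rfl | rfl | rfl | rfl | rfl | rfl | rfl | rfl <;> simp at hz ⊢ <;> omega

lemma exists_isKuhnLabelling_of_mem_refine (hn : n = 2 ∨ n = 3) (f : E n →ᵃ[ℝ] ℝ)
    {y : Fin (n + 1) → E n} {z : Fin (n + 1) → ℤ} (hfz : ∀ k, f (y k) = z k)
    (hz : IsKuhnLabelling z) {m : ℕ} {t : Fin (n + 1) → E n} (ht : t ∈ refine m y) :
    ∃ z' : Fin (n + 1) → ℤ, IsKuhnLabelling z' ∧ ∀ k, 2 ^ m * f (t k) = z' k := by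
  induction m generalizing t with
  | zero => obtain rfl := ht; exact ⟨z, hz, by simpa using hfz⟩
  | succ m ih =>
    obtain ⟨s, hs, hts⟩ := mem_iUnion₂.1 ht
    obtain ⟨z', hz', hfz'⟩ := ih hs
    obtain ⟨e, he, rfl⟩ := mem_subdivide_iff.1 hts
    refine ⟨_, hz'.child hn he, fun k => ?_⟩
    rw [AffineMap.map_midpoint, midpoint_eq_smul_add, Int.cast_add, ← hfz', ← hfz', invOf_eq_inv,
      smul_eq_mul]
    ring

lemma mem_of_mem_refine {s : Set (E n)} (hs : Convex ℝ s) {y : Fin (n + 1) → E n}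
    (hy : ∀ k, y k ∈ s) {m : ℕ} {t : Fin (n + 1) → E n} (ht : t ∈ refine m y) (k : Fin (n + 1)) :
    t k ∈ s := by
  induction m generalizing t k with
  | zero => obtain rfl := ht; exact hy k
  | succ m ih =>
    obtain ⟨u, hu, htu⟩ := mem_iUnion₂.1 ht
    obtain ⟨e, -, rfl⟩ := mem_subdivide_iff.1 htu
    exact hs.midpoint_mem (ih hu _) (ih hu _)

lemma exists_childEdges_weights_two {w : Fin 3 → ℝ} (hw : w ∈ stdSimplex ℝ (Fin 3)) :
    ∃ e ∈ childEdges 2, ∃ w' : Fin 3 → ℝ, (∀ k, 0 ≤ w' k) ∧ ∀ l,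
      ∑ k, w' k * ((if (e k).1 = l then 1 else 0) + if (e k).2 = l then 1 else 0) = 2 * w l := by
  have hpos : 0 ≤ w 0 ∧ 0 ≤ w 1 ∧ 0 ≤ w 2 := by simpa [Fin.forall_fin_succ] using hw.1
  have hsum : w 0 + w 1 + w 2 = 1 := by simpa [Fin.sum_univ_three] using hw.2
  simp only [Fin.forall_fin_succ, Fin.sum_univ_three]
  by_cases h₀ : 1 / 2 ≤ w 0
  · refine ⟨_, .inl rfl, ![2 * w 0 - 1, 2 * w 1, 2 * w 2], ?_⟩
    simp; grind
  by_cases h₁ : 1 / 2 ≤ w 1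
  · refine ⟨_, .inr (.inl rfl), ![2 * w 0, 2 * w 1 - 1, 2 * w 2], ?_⟩
    simp; grind
  by_cases h₂ : 1 / 2 ≤ w 2
  · refine ⟨_, .inr (.inr (.inl rfl)), ![2 * w 0, 2 * w 1, 2 * w 2 - 1], ?_⟩
    simp; grind
  · refine ⟨_, .inr (.inr (.inr rfl)), ![1 - 2 * w 2, 1 - 2 * w 0, 1 - 2 * w 1], ?_⟩
    simp; grind

lemma exists_childEdges_weights_three {w : Fin 4 → ℝ} (hw : w ∈ stdSimplex ℝ (Fin 4)) :
    ∃ e ∈ childEdges 3, ∃ w' : Fin 4 → ℝ, (∀ k, 0 ≤ w' k) ∧ ∀ l,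
      ∑ k, w' k * ((if (e k).1 = l then 1 else 0) + if (e k).2 = l then 1 else 0) = 2 * w l := by
  have hpos : 0 ≤ w 0 ∧ 0 ≤ w 1 ∧ 0 ≤ w 2 ∧ 0 ≤ w 3 := by
    simpa [Fin.forall_fin_succ] using hw.1
  have hsum : w 0 + w 1 + w 2 + w 3 = 1 := by simpa [Fin.sum_univ_four] using hw.2
  simp only [Fin.forall_fin_succ, Fin.sum_univ_four]
  by_cases h₀ : 1 / 2 ≤ w 0
  · refine ⟨_, .inl rfl, ![2 * w 0 - 1, 2 * w 1, 2 * w 2, 2 * w 3], ?_⟩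
    simp; grind
  by_cases h₁ : 1 / 2 ≤ w 1
  · refine ⟨_, .inr (.inl rfl), ![2 * w 0, 2 * w 1 - 1, 2 * w 2, 2 * w 3], ?_⟩
    simp; grind
  by_cases h₂ : 1 / 2 ≤ w 2
  · refine ⟨_, .inr (.inr (.inl rfl)), ![2 * w 0, 2 * w 1, 2 * w 2 - 1, 2 * w 3], ?_⟩
    simp; grind
  by_cases h₃ : 1 / 2 ≤ w 3
  · refine ⟨_, .inr (.inr (.inr (.inl rfl))), ![2 * w 0, 2 * w 1, 2 * w 2, 2 * w 3 - 1], ?_⟩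
    simp; grind
  push Not at h₀ h₁ h₂ h₃
  -- The inner octahedron is cut along its diagonal by the planes `s = 0` and `u = 0`.
  obtain ⟨s, hs⟩ : ∃ s, s = w 0 + w 1 - w 2 - w 3 := ⟨_, rfl⟩
  obtain ⟨u, hu⟩ : ∃ u, u = w 0 + w 3 - w 1 - w 2 := ⟨_, rfl⟩
  rcases le_total 0 s with hs₀ | hs₀ <;> rcases le_total 0 u with hu₀ | hu₀
  · refine ⟨_, .inr (.inr (.inr (.inr (.inl rfl)))), ![s, 2 * w 2, u, 1 - 2 * w 0], ?_⟩
    simp; grind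
  · refine ⟨_, .inr (.inr (.inr (.inr (.inr (.inl rfl))))), ![s, 1 - 2 * w 1, -u, 2 * w 3], ?_⟩
    simp; grind
  · refine ⟨_, .inr (.inr (.inr (.inr (.inr (.inr (.inl rfl)))))),
      ![1 - 2 * w 3, u, 2 * w 1, -s], ?_⟩
    simp; grind
  · refine ⟨_, .inr (.inr (.inr (.inr (.inr (.inr (.inr rfl)))))),
      ![2 * w 0, -u, 1 - 2 * w 2, -s], ?_⟩
    simp; grind

lemma sum_smul_midpoint_eq {ι κ V : Type*} [Fintype ι] [Fintype κ] [DecidableEq κ]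
    [AddCommGroup V] [Module ℝ V] {e : ι → κ × κ} {w : ι → ℝ} {w' : κ → ℝ}
    (h : ∀ l, ∑ k, w k * ((if (e k).1 = l then 1 else 0) + if (e k).2 = l then 1 else 0) =
      2 * w' l) (y : κ → V) :
    ∑ k, w k • midpoint ℝ (y (e k).1) (y (e k).2) = ∑ l, w' l • y l := by
  have hmid : ∀ k, w k • midpoint ℝ (y (e k).1) (y (e k).2) = (1 / 2 : ℝ) • ∑ l,
      (w k * ((if (e k).1 = l then 1 else 0) + if (e k).2 = l then 1 else 0)) • y l := by
    intro k
    simp only [mul_smul, add_smul, ite_smul, one_smul, zero_smul, ← Finset.smul_sum,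
      Finset.sum_add_distrib, Finset.sum_ite_eq, Finset.mem_univ, if_true]
    rw [midpoint_eq_smul_add, invOf_eq_inv, one_div, smul_comm]
  simp only [hmid, ← Finset.smul_sum]
  rw [Finset.sum_comm]
  simp only [← Finset.sum_smul, h, Finset.smul_sum, smul_smul, one_div]
  simp

lemma exists_mem_subdivide_combination (hn : n = 2 ∨ n = 3) (y : Fin (n + 1) → E n)
    {w : Fin (n + 1) → ℝ} (hw : w ∈ stdSimplex ℝ (Fin (n + 1))) :
    ∃ t ∈ subdivide y, ∃ w' ∈ stdSimplex ℝ (Fin (n + 1)), ∑ k, w' k • t k = ∑ k, w k • y k := by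
  obtain ⟨e, he, w', hw', h⟩ : ∃ e ∈ childEdges n, ∃ w' : Fin (n + 1) → ℝ, (∀ k, 0 ≤ w' k) ∧
      ∀ l, ∑ k, w' k * ((if (e k).1 = l then 1 else 0) + if (e k).2 = l then 1 else 0) =
        2 * w l := by
    rcases hn with rfl | rfl
    · exact exists_childEdges_weights_two hw
    · exact exists_childEdges_weights_three hw
  refine ⟨_, mem_subdivide_iff.2 ⟨e, he, rfl⟩, w', ⟨hw', ?_⟩, sum_smul_midpoint_eq h y⟩
  simpa [hw.2] using sum_smul_midpoint_eq h (1 : Fin (n + 1) → ℝ)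

lemma exists_mem_refine_combination (hn : n = 2 ∨ n = 3) (y : Fin (n + 1) → E n)
    {w : Fin (n + 1) → ℝ} (hw : w ∈ stdSimplex ℝ (Fin (n + 1))) (m : ℕ) :
    ∃ t ∈ refine m y, ∃ w' ∈ stdSimplex ℝ (Fin (n + 1)), ∑ k, w' k • t k = ∑ k, w k • y k := by
  induction m with
  | zero => exact ⟨y, rfl, w, hw, rfl⟩
  | succ m ih =>
    obtain ⟨t, ht, w', hw', h⟩ := ih
    obtain ⟨s, hs, w'', hw'', h'⟩ := exists_mem_subdivide_combination hn t hw'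
    exact ⟨s, mem_iUnion₂.2 ⟨t, ht, hs⟩, w'', hw'', h'.trans h⟩

/-! ### Barycentric coordinates -/

/-- The vertices of a macro-element as an affine basis. -/
def vertexBasis (T : Macro n) : AffineBasis (Fin (n + 1)) ℝ (E n) where
  toFun := T.points
  ind' := T.independent
  tot' := T.independent.affineSpan_eq_top_iff_card_eq_finrank_add_one.2 (by simp)

/-- The barycentric coordinates of a macro-element. -/
def baryCoord (T : Macro n) (k : Fin (n + 1)) : E n →ᵃ[ℝ] ℝ := (vertexBasis T).coord k

/-- The linear parts of the barycentric coordinates, which act on differences of points. -/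
def baryDir (T : Macro n) (k : Fin (n + 1)) : E n →ₗ[ℝ] ℝ := (baryCoord T k).linear

lemma baryCoord_sub (T : Macro n) (k : Fin (n + 1)) (x y : E n) :
    baryCoord T k x - baryCoord T k y = baryDir T k (x - y) :=
  ((baryCoord T k).linearMap_vsub x y).symm

lemma baryCoord_add (T : Macro n) (k : Fin (n + 1)) (x v : E n) :
    baryCoord T k (x + v) = baryCoord T k x + baryDir T k v := by
  have := baryCoord_sub T k (x + v) x
  rw [add_sub_cancel_left] at this
  linarith

lemma sum_baryCoord (T : Macro n) (x : E n) : ∑ k, baryCoord T k x = 1 :=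
  (vertexBasis T).sum_coord_apply_eq_one x

lemma sum_baryCoord_smul (T : Macro n) (x : E n) : ∑ k, baryCoord T k x • T.points k = x :=
  (vertexBasis T).linear_combination_coord_eq_self x

lemma sum_baryDir (T : Macro n) (v : E n) : ∑ k, baryDir T k v = 0 := by
  rw [← sub_zero v]
  simp only [← baryCoord_sub, Finset.sum_sub_distrib, sum_baryCoord, sub_self]

lemma sum_baryDir_smul (T : Macro n) (v : E n) : ∑ k, baryDir T k v • T.points k = v := by
  rw [← sub_zero v]
  simp only [← baryCoord_sub, sub_smul, Finset.sum_sub_distrib, sum_baryCoord_smul]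

lemma baryCoord_point (T : Macro n) (k l : Fin (n + 1)) :
    baryCoord T k (T.points l) = if k = l then 1 else 0 :=
  (vertexBasis T).coord_apply k l

lemma baryCoord_sum_smul_points (T : Macro n) {w : Fin (n + 1) → ℝ} (hw : ∑ k, w k = 1)
    (k : Fin (n + 1)) : baryCoord T k (∑ l, w l • T.points l) = w k := by
  have h := (vertexBasis T).coord_apply_combination_of_mem (Finset.mem_univ k) hw
  rwa [Finset.affineCombination_eq_linear_combination _ _ _ hw] at h

lemma mem_closedInterior_iff {T : Macro n} {x : E n} :
    x ∈ T.closedInterior ↔ ∀ k, 0 ≤ baryCoord T k x := by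
  rw [← Affine.Simplex.convexHull_eq_closedInterior]
  change x ∈ convexHull ℝ (range (vertexBasis T)) ↔ _
  rw [(vertexBasis T).convexHull_eq_nonneg_coord]
  rfl

lemma convex_closedInterior (T : Macro n) : Convex ℝ T.closedInterior := by
  rw [← Affine.Simplex.convexHull_eq_closedInterior]
  exact convex_convexHull _ _

lemma mem_interior_iff (hn : n ≠ 0) {T : Macro n} {x : E n} :
    x ∈ T.interior ↔ ∀ k, 0 < baryCoord T k x := by
  have hx : Finset.univ.affineCombination ℝ T.points (baryCoord T · x) = x :=
    (vertexBasis T).affineCombination_coord_eq_self x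
  conv_lhs => rw [← hx, Affine.Simplex.affineCombination_mem_interior_iff (sum_baryCoord T x)]
  refine ⟨fun h k => (h k).1, fun h k => ⟨h k, ?_⟩⟩
  have : Nontrivial (Fin (n + 1)) := Fin.nontrivial_iff_two_le.2 (by omega)
  obtain ⟨l, hl⟩ := exists_ne k
  rw [← sum_baryCoord T x]
  exact Finset.single_lt_sum hl (Finset.mem_univ k) (Finset.mem_univ l) (h l) fun i _ _ => (h i).le

lemma interior_closedInterior (hn : n ≠ 0) (T : Macro n) :
    interior T.closedInterior = T.interior := by
  ext x
  rw [← Affine.Simplex.convexHull_eq_closedInterior, mem_interior_iff hn]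
  exact Set.ext_iff.1 (vertexBasis T).interior_convexHull x

lemma isOpen_interior_simplex (hn : n ≠ 0) (T : Macro n) : IsOpen T.interior := by
  rw [← interior_closedInterior hn]
  exact isOpen_interior

lemma convex_interior_simplex (hn : n ≠ 0) (T : Macro n) : Convex ℝ T.interior := by
  rw [← interior_closedInterior hn]
  exact (convex_closedInterior T).interior

lemma closure_interior_simplex (hn : n ≠ 0) (T : Macro n) :
    closure T.interior = T.closedInterior := by
  have hne : (interior T.closedInterior).Nonempty := by
    rw [← Affine.Simplex.convexHull_eq_closedInterior]
    exact ⟨_, (vertexBasis T).centroid_mem_interior_convexHull⟩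
  rw [← interior_closedInterior hn,
    (convex_closedInterior T).closure_interior_eq_closure_of_nonempty_interior hne,
    T.isClosed_closedInterior.closure_eq]

lemma dist_points_le_elemDiam (T : Macro n) (k l : Fin (n + 1)) :
    dist (T.points k) (T.points l) ≤ elemDiam T :=
  Metric.dist_le_diam_of_mem T.isCompact_closedInterior.isBounded
    (T.point_mem_closedInterior k) (T.point_mem_closedInterior l)

lemma elemDiam_pos (hn : n ≠ 0) (T : Macro n) : 0 < elemDiam T := by
  have : Nontrivial (Fin (n + 1)) := Fin.nontrivial_iff_two_le.2 (by omega)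
  obtain ⟨k, hk⟩ := exists_ne (0 : Fin (n + 1))
  exact (dist_pos.2 (T.independent.injective.ne hk)).trans_le (dist_points_le_elemDiam T k 0)

lemma abs_baryDir_le_of_closedBall_subset {T : Macro n} {z : E n} {ρ : ℝ} (hρ : 0 < ρ)
    (h : Metric.closedBall z ρ ⊆ T.closedInterior) (k : Fin (n + 1)) (v : E n) :
    |baryDir T k v| ≤ ‖v‖ / ρ := by
  have hle : ∀ u : E n, ‖u‖ ≤ ρ → baryDir T k u ≤ 1 := by
    intro u hu
    have hz := mem_closedInterior_iff.1 (h (Metric.mem_closedBall_self hρ.le)) k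
    have hzu := mem_closedInterior_iff.1 (h (show z + u ∈ _ by simpa using hu))
    have hzu' : baryCoord T k (z + u) ≤ 1 := by
      rw [← sum_baryCoord T (z + u)]
      exact Finset.single_le_sum (fun i _ => hzu i) (Finset.mem_univ k)
    rw [baryCoord_add] at hzu'
    linarith
  have hball : ∀ u ∈ Metric.closedBall (0 : E n) ρ, ‖baryDir T k u‖ ≤ 1 := by
    intro u hu
    rw [mem_closedBall_zero_iff] at hu
    have hneg := hle (-u) (by rwa [norm_neg])
    rw [map_neg] at hneg
    exact abs_le.2 ⟨by linarith, hle u hu⟩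
  rw [div_eq_inv_mul, ← one_div]
  exact (baryDir T k).bound_of_ball_bound' hρ 1 hball v

/-! ### Hat functions of the uniform refinement -/

/-- Partial sums of the linear parts of the barycentric coordinates: in the linear coordinates
`tail T 1, …, tail T n` the uniform refinement is Kuhn's triangulation. -/
def tail (T : Macro n) (i : Fin (n + 1)) : E n →ₗ[ℝ] ℝ := ∑ k ∈ Finset.Ici i, baryDir T k

/-- The functionals whose level sets at multiples of `2⁻ᵐ` carry the facets of the refinement of
level `m`. -/
def wall (T : Macro n) (p : Fin (n + 1) × Fin (n + 1)) : E n →ₗ[ℝ] ℝ := tail T p.1 - tail T p.2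

/-- The largest value of the wall functionals. Its ball of radius `2⁻ᵐ` is the support of a hat
function of the refinement of level `m`. -/
def wallSeminorm (T : Macro n) : Seminorm ℝ (E n) :=
  Finset.univ.sup fun p => (wall T p).toSeminorm

/-- The hat function of the origin for the triangulation of the whole space that continues the
refinement of level `m` of `T`. -/
def hatFn (m : ℕ) (T : Macro n) (v : E n) : ℝ := max 0 (1 - 2 ^ m * wallSeminorm T v)

lemma tail_apply (T : Macro n) (i : Fin (n + 1)) (v : E n) :
    tail T i v = ∑ k ∈ Finset.Ici i, baryDir T k v := by
  simp [tail]

lemma tail_zero (T : Macro n) (v : E n) : tail T 0 v = 0 := by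
  rw [tail_apply, ← sum_baryDir T v, ← bot_eq_zero, Finset.Ici_bot]

lemma tail_last (T : Macro n) (v : E n) : tail T (Fin.last n) v = baryDir T (Fin.last n) v := by
  rw [tail_apply, ← Fin.top_eq_last, Finset.Ici_top, Finset.sum_singleton]

lemma tail_castSucc (T : Macro n) (i : Fin n) (v : E n) :
    tail T i.castSucc v = baryDir T i.castSucc v + tail T i.succ v := by
  have hIci : Finset.Ici i.castSucc = insert i.castSucc (Finset.Ici i.succ) := by
    ext j
    simp only [Finset.mem_Ici, Finset.mem_insert]
    grind
  rw [tail_apply, tail_apply, hIci, Finset.sum_insert (by simp)]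

lemma wall_apply (T : Macro n) (p : Fin (n + 1) × Fin (n + 1)) (v : E n) :
    wall T p v = tail T p.1 v - tail T p.2 v := rfl

lemma wall_swap (T : Macro n) (p : Fin (n + 1) × Fin (n + 1)) (v : E n) :
    wall T p.swap v = -wall T p v :=
  (neg_sub _ _).symm

lemma abs_wall_le (T : Macro n) (p : Fin (n + 1) × Fin (n + 1)) (v : E n) :
    |wall T p v| ≤ wallSeminorm T v :=
  Seminorm.le_finset_sup_apply (p := fun p => (wall T p).toSeminorm) (Finset.mem_univ p)

lemma exists_wallSeminorm_eq (T : Macro n) (v : E n) : ∃ p, wallSeminorm T v = wall T p v := by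
  obtain ⟨p, -, hp⟩ := Seminorm.exists_apply_eq_finset_sup (fun p => (wall T p).toSeminorm)
    Finset.univ_nonempty v
  rcases abs_choice (wall T p v) with h | h
  · exact ⟨p, hp.trans h⟩
  · exact ⟨p.swap, hp.trans (h.trans (wall_swap T p v).symm)⟩

lemma abs_baryDir_le_wallSeminorm (T : Macro n) (k : Fin (n + 1)) (v : E n) :
    |baryDir T k v| ≤ wallSeminorm T v := by
  cases k using Fin.lastCases with
  | last => simpa [wall_apply, tail_zero, tail_last] using abs_wall_le T (Fin.last n, 0) v
  | cast i => simpa [wall_apply, tail_castSucc] using abs_wall_le T (i.castSucc, i.succ) v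

lemma wallSeminorm_le_of_abs_baryDir_le {T : Macro n} {v : E n} {c : ℝ}
    (h : ∀ k, |baryDir T k v| ≤ c) : wallSeminorm T v ≤ 2 * (n + 1) * c := by
  have htail : ∀ i, |tail T i v| ≤ (n + 1) * c := by
    intro i
    rw [tail_apply]
    calc |∑ k ∈ Finset.Ici i, baryDir T k v| ≤ ∑ k ∈ Finset.Ici i, |baryDir T k v| :=
          Finset.abs_sum_le_sum_abs _ _
      _ ≤ ∑ k, |baryDir T k v| :=
          Finset.sum_le_sum_of_subset_of_nonneg (Finset.subset_univ _) fun _ _ _ => abs_nonneg _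
      _ ≤ ∑ _k : Fin (n + 1), c := Finset.sum_le_sum fun k _ => h k
      _ = (n + 1) * c := by simp
  obtain ⟨p, hp⟩ := exists_wallSeminorm_eq T v
  rw [hp, wall_apply]
  linarith [le_of_abs_le (htail p.1), neg_le_of_abs_le (htail p.2)]

lemma norm_le_wallSeminorm (T : Macro n) (v : E n) :
    ‖v‖ ≤ (n + 1) * elemDiam T * wallSeminorm T v := by
  have hv : v = ∑ k, baryDir T k v • (T.points k - T.points 0) := by
    simp only [smul_sub, Finset.sum_sub_distrib, sum_baryDir_smul, ← Finset.sum_smul, sum_baryDir,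
      zero_smul, sub_zero]
  calc ‖v‖ = ‖∑ k, baryDir T k v • (T.points k - T.points 0)‖ := by rw [← hv]
    _ ≤ ∑ k, ‖baryDir T k v • (T.points k - T.points 0)‖ := norm_sum_le _ _
    _ ≤ ∑ _k : Fin (n + 1), wallSeminorm T v * elemDiam T := by
        gcongr with k
        rw [norm_smul, Real.norm_eq_abs, ← dist_eq_norm]
        gcongr
        · exact abs_baryDir_le_wallSeminorm T k v
        · exact dist_points_le_elemDiam T k 0
    _ = (n + 1) * elemDiam T * wallSeminorm T v := by simp; ring

lemma hatFn_nonneg (m : ℕ) (T : Macro n) (v : E n) : 0 ≤ hatFn m T v := le_max_left _ _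

lemma hatFn_ne_zero_iff {m : ℕ} {T : Macro n} {v : E n} :
    hatFn m T v ≠ 0 ↔ 2 ^ m * wallSeminorm T v < 1 := by
  rw [hatFn, Ne, max_eq_left_iff, not_le, sub_pos]

lemma mem_lattice_iff {m : ℕ} {T : Macro n} {x : E n} :
    x ∈ lattice m T ↔ ∀ k, ∃ a : ℕ, 2 ^ m * baryCoord T k x = a := by
  have hpow : (2 : ℝ) ^ m ≠ 0 := by positivity
  constructor
  · rintro ⟨a, ha, rfl⟩ k
    have hsum : ∑ i, (a i : ℝ) / 2 ^ m = 1 := by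
      rw [← Finset.sum_div, div_eq_one_iff_eq hpow]
      exact_mod_cast ha
    exact ⟨a k, by rw [baryCoord_sum_smul_points T hsum, mul_div_cancel₀ _ hpow]⟩
  · intro h
    choose a ha using h
    refine ⟨a, ?_, ?_⟩
    · suffices ((∑ i, a i : ℕ) : ℝ) = 2 ^ m by exact_mod_cast this
      rw [Nat.cast_sum, ← Finset.sum_congr rfl fun i _ => ha i, ← Finset.mul_sum, sum_baryCoord,
        mul_one]
    · simp only [← ha, mul_div_cancel_left₀ _ hpow, sum_baryCoord_smul]

lemma point_mem_lattice (m : ℕ) (T : Macro n) (k : Fin (n + 1)) : T.points k ∈ lattice m T := by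
  refine mem_lattice_iff.2 fun l => ?_
  rw [baryCoord_point]
  split_ifs
  · exact ⟨2 ^ m, by simp⟩
  · exact ⟨0, by simp⟩

lemma lattice_subset_closedInterior (m : ℕ) (T : Macro n) : lattice m T ⊆ T.closedInterior := by
  intro x hx
  refine mem_closedInterior_iff.2 fun k => ?_
  obtain ⟨a, ha⟩ := mem_lattice_iff.1 hx k
  have hmul : 0 ≤ 2 ^ m * baryCoord T k x := by rw [ha]; positivity
  exact nonneg_of_mul_nonneg_right hmul (by positivity)

lemma exists_int_wall {m : ℕ} {T : Macro n} {x y : E n} (hx : x ∈ lattice m T)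
    (hy : y ∈ lattice m T) (p : Fin (n + 1) × Fin (n + 1)) :
    ∃ a : ℤ, 2 ^ m * wall T p (x - y) = a := by
  choose a ha using mem_lattice_iff.1 hx
  choose b hb using mem_lattice_iff.1 hy
  have hdir : ∀ k, 2 ^ m * baryDir T k (x - y) = ((a k - b k : ℤ) : ℝ) := by
    intro k
    rw [← baryCoord_sub, mul_sub, ha, hb]
    push_cast
    rfl
  refine ⟨∑ k ∈ Finset.Ici p.1, (a k - b k : ℤ) - ∑ k ∈ Finset.Ici p.2, (a k - b k : ℤ), ?_⟩
  simp only [wall_apply, tail_apply, mul_sub, Finset.mul_sum, hdir, Int.cast_sub, Int.cast_sum]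

lemma hatFn_sub_of_mem_lattice {m : ℕ} {T : Macro n} {x y : E n} (hx : x ∈ lattice m T)
    (hy : y ∈ lattice m T) : hatFn m T (x - y) = indicator {y} (fun _ => (1 : ℝ)) x := by
  rcases eq_or_ne x y with rfl | hne
  · simp [hatFn]
  rw [indicator_of_notMem (by simpa using hne)]
  by_contra h
  obtain ⟨p, hp⟩ := exists_wallSeminorm_eq T (x - y)
  obtain ⟨a, ha⟩ := exists_int_wall hx hy p
  have ha1 := hatFn_ne_zero_iff.1 h
  rw [hp, ha] at ha1
  have ha0 : a ≤ 0 := Int.lt_add_one_iff.1 (by exact_mod_cast ha1)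
  have hzero : wallSeminorm T (x - y) ≤ 0 := by
    refine nonpos_of_mul_nonpos_right (a := (2 : ℝ) ^ m) ?_ (by positivity)
    rw [hp, ha]
    exact_mod_cast ha0
  have hnorm := norm_le_wallSeminorm T (x - y)
  rw [hzero.antisymm (apply_nonneg _ _), mul_zero] at hnorm
  exact hne (sub_eq_zero.1 (norm_le_zero_iff.1 hnorm))

lemma mem_lattice_of_mem_refine (hn : n = 2 ∨ n = 3) {m : ℕ} {T : Macro n}
    {t : Fin (n + 1) → E n} (ht : t ∈ refine m T.points) (k : Fin (n + 1)) :
    t k ∈ lattice m T := by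
  refine mem_lattice_iff.2 fun l => ?_
  have hlabel : IsKuhnLabelling fun k : Fin (n + 1) => if l = k then (1 : ℤ) else 0 :=
    ⟨fun _ _ => by dsimp only; grind, fun _ _ _ _ _ _ _ => by dsimp only; grind⟩
  obtain ⟨z, -, hz⟩ := exists_isKuhnLabelling_of_mem_refine hn (baryCoord T l)
    (fun k => by rw [baryCoord_point]; push_cast; rfl) hlabel ht
  have hnonneg : 0 ≤ baryCoord T l (t k) := mem_closedInterior_iff.1
    (mem_of_mem_refine (convex_closedInterior T) T.point_mem_closedInterior ht k) l
  have hz0 : 0 ≤ z k := by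
    have hmul : (0 : ℝ) ≤ z k := by rw [← hz]; positivity
    exact_mod_cast hmul
  lift z k to ℕ using hz0 with a ha
  exact ⟨a, by rw [hz, ← ha, Int.cast_natCast]⟩

lemma tail_point_sub_point_zero (T : Macro n) (i l : Fin (n + 1)) :
    tail T i (T.points l - T.points 0) = (if i ≤ l then 1 else 0) - if i = 0 then 1 else 0 := by
  simp [tail_apply, ← baryCoord_sub, baryCoord_point]

lemma exists_wall_labelling_of_mem_refine (hn : n = 2 ∨ n = 3) {m : ℕ} {T : Macro n}
    {t : Fin (n + 1) → E n} (ht : t ∈ refine m T.points) {y : E n} (hy : y ∈ lattice m T)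
    (p : Fin (n + 1) × Fin (n + 1)) :
    ∃ z : Fin (n + 1) → ℤ, (∀ i j, z i ≤ z j + 1) ∧ ∀ k, 2 ^ m * wall T p (t k - y) = z k := by
  let f : E n →ᵃ[ℝ] ℝ := (wall T p).toAffineMap - AffineMap.const ℝ (E n) (wall T p (T.points 0))
  have hf : ∀ x, f x = wall T p (x - T.points 0) := fun x => by simp [f]
  let z : Fin (n + 1) → ℤ := fun l => ((if p.1 ≤ l then 1 else 0) - if p.1 = 0 then 1 else 0) -
    ((if p.2 ≤ l then 1 else 0) - if p.2 = 0 then 1 else 0)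
  have hfz : ∀ l, f (T.points l) = z l := by
    intro l
    rw [hf, wall_apply, tail_point_sub_point_zero, tail_point_sub_point_zero]
    push_cast [z]
    rfl
  have hz : IsKuhnLabelling z :=
    ⟨fun _ _ => by simp only [z]; grind, fun _ _ _ _ _ _ _ => by simp only [z]; grind⟩
  obtain ⟨z', hz', hfz'⟩ := exists_isKuhnLabelling_of_mem_refine hn f hfz hz ht
  obtain ⟨b, hb⟩ := exists_int_wall hy (point_mem_lattice m T 0) p
  refine ⟨fun k => z' k - b, fun i j => by linarith [hz'.1 i j], fun k => ?_⟩
  rw [Int.cast_sub, ← hfz', hf, ← hb, ← mul_sub, ← map_sub, sub_sub_sub_cancel_right]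

lemma nonneg_of_sum_mul_nonneg {ι : Type*} [Fintype ι] {z : ι → ℤ} (hz : ∀ i j, z i ≤ z j + 1)
    {w : ι → ℝ} (hw : ∀ i, 0 ≤ w i) (hsum : 0 ≤ ∑ i, w i * z i) {k : ι} (hk : 0 < w k) :
    0 ≤ z k := by
  by_contra! hneg
  have hnonpos : ∀ i, (z i : ℝ) ≤ 0 := fun i => by exact_mod_cast (hz i k).trans (by omega)
  refine hsum.not_gt (Finset.sum_neg' (fun i _ => ?_) ⟨k, Finset.mem_univ k, ?_⟩)
  · exact mul_nonpos_of_nonneg_of_nonpos (hw i) (hnonpos i)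
  · exact mul_neg_of_pos_of_neg hk (by exact_mod_cast hneg)

lemma max_zero_one_sub_sum_mul {ι : Type*} [Fintype ι] {z : ι → ℤ} (hz : ∀ i j, z i ≤ z j + 1)
    {w : ι → ℝ} (hw : w ∈ stdSimplex ℝ ι) :
    max 0 (1 - ∑ i, w i * z i) = ∑ i, w i * max 0 (1 - (z i : ℝ)) := by
  have hsum : 1 - ∑ i, w i * z i = ∑ i, w i * (1 - (z i : ℝ)) := by
    simp only [mul_sub, mul_one, Finset.sum_sub_distrib, hw.2]
  rw [hsum]
  by_cases h : ∃ k, z k ≤ 0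
  · obtain ⟨k, hk⟩ := h
    have hle : ∀ i, 0 ≤ 1 - (z i : ℝ) := fun i => by
      have : z i ≤ 1 := (hz i k).trans (by omega)
      exact sub_nonneg.2 (by exact_mod_cast this)
    simp only [max_eq_right (hle _)]
    exact max_eq_right (Finset.sum_nonneg fun i _ => mul_nonneg (hw.1 i) (hle i))
  · push Not at h
    have hle : ∀ i, 1 - (z i : ℝ) ≤ 0 := fun i => sub_nonpos.2 (by exact_mod_cast h i)
    simp only [max_eq_left (hle _), mul_zero, Finset.sum_const_zero]
    exact max_eq_left (Finset.sum_nonpos fun i _ =>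
      mul_nonpos_of_nonneg_of_nonpos (hw.1 i) (hle i))

-- `wall (i, j) + wall (j, k) = wall (i, k)`, so maximality of a wall functional amounts to the
-- nonnegativity of others, and that passes to the vertices carrying the combination.
lemma exists_wallSeminorm_eq_of_combination (hn : n = 2 ∨ n = 3) {m : ℕ} {T : Macro n}
    {t : Fin (n + 1) → E n} (ht : t ∈ refine m T.points) {y : E n} (hy : y ∈ lattice m T)
    {w : Fin (n + 1) → ℝ} (hw : ∀ k, 0 ≤ w k) :
    ∃ p, wallSeminorm T (∑ k, w k • (t k - y)) = wall T p (∑ k, w k • (t k - y)) ∧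
      ∀ k, 0 < w k → wallSeminorm T (t k - y) = wall T p (t k - y) := by
  set v := ∑ k, w k • (t k - y) with hv
  have hpow : (0 : ℝ) < 2 ^ m := by positivity
  have hnonneg : ∀ q, 0 ≤ wall T q v → ∀ k, 0 < w k → 0 ≤ wall T q (t k - y) := by
    intro q hq k hk
    obtain ⟨z, hz, hzwall⟩ := exists_wall_labelling_of_mem_refine hn ht hy q
    have hsum : 2 ^ m * wall T q v = ∑ k, w k * z k := by
      simp only [hv, map_sum, map_smul, smul_eq_mul, Finset.mul_sum, ← hzwall, mul_left_comm]
    have hzk := nonneg_of_sum_mul_nonneg hz hw (by rw [← hsum]; positivity) hk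
    refine nonneg_of_mul_nonneg_right (b := wall T q (t k - y)) ?_ hpow
    rw [hzwall]
    exact_mod_cast hzk
  obtain ⟨p, hp⟩ := exists_wallSeminorm_eq T v
  refine ⟨p, hp, fun k hk => le_antisymm ?_ (le_of_abs_le (abs_wall_le T p _))⟩
  obtain ⟨q, hq⟩ := exists_wallSeminorm_eq T (t k - y)
  have hv₁ : 0 ≤ wall T (p.1, q.1) v := by
    have h := le_of_abs_le (abs_wall_le T (q.1, p.2) v)
    simp only [hp, wall_apply] at h ⊢
    linarith
  have hv₂ : 0 ≤ wall T (q.2, p.2) v := by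
    have h := le_of_abs_le (abs_wall_le T (p.1, q.2) v)
    simp only [hp, wall_apply] at h ⊢
    linarith
  have h₁ := hnonneg _ hv₁ k hk
  have h₂ := hnonneg _ hv₂ k hk
  simp only [hq, wall_apply] at h₁ h₂ ⊢
  linarith

lemma hatFn_combination_sub (hn : n = 2 ∨ n = 3) {m : ℕ} {T : Macro n} {t : Fin (n + 1) → E n}
    (ht : t ∈ refine m T.points) {y : E n} (hy : y ∈ lattice m T) {w : Fin (n + 1) → ℝ}
    (hw : w ∈ stdSimplex ℝ (Fin (n + 1))) :
    hatFn m T (∑ k, w k • t k - y) = ∑ k, w k * indicator {y} (fun _ => (1 : ℝ)) (t k) := by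
  have hv : ∑ k, w k • t k - y = ∑ k, w k • (t k - y) := by
    simp only [smul_sub, Finset.sum_sub_distrib, ← Finset.sum_smul, hw.2, one_smul]
  obtain ⟨p, hp, hpk⟩ := exists_wallSeminorm_eq_of_combination hn ht hy hw.1
  obtain ⟨z, hz, hzwall⟩ := exists_wall_labelling_of_mem_refine hn ht hy p
  have hsum : 2 ^ m * wall T p (∑ k, w k • (t k - y)) = ∑ k, w k * z k := by
    simp only [map_sum, map_smul, smul_eq_mul, Finset.mul_sum, ← hzwall, mul_left_comm]
  rw [hv, hatFn, hp, hsum, max_zero_one_sub_sum_mul hz hw]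
  refine Finset.sum_congr rfl fun k _ => ?_
  rw [← hatFn_sub_of_mem_lattice (mem_lattice_of_mem_refine hn ht k) hy]
  rcases (hw.1 k).eq_or_lt with hk | hk
  · rw [← hk, zero_mul, zero_mul]
  · rw [hatFn, hpk k hk, hzwall]

/-! ### Vertex functions of a macro-mesh -/

section VertexFn

variable {Ω : Set (E n)} {Th : Set (Macro n)} {m : ℕ} {T : Macro n}

lemma IsMacroMesh.eq_of_mem_interior (hn : n ≠ 0) (h : IsMacroMesh Ω Th) {T' : Macro n}
    (hT : T ∈ Th) (hT' : T' ∈ Th) {x : E n} (hx : x ∈ T.interior) (hx' : x ∈ T'.closedInterior) :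
    T' = T := by
  by_contra hne
  rw [← closure_interior_simplex hn, mem_closure_iff] at hx'
  obtain ⟨y, hy, hy'⟩ := hx' _ (isOpen_interior_simplex hn T) hx
  exact disjoint_left.1 (h.disjoint T' hT' T hT hne) hy' hy

lemma IsMacroMesh.interior_subset (hn : n ≠ 0) (h : IsMacroMesh Ω Th) (hT : T ∈ Th) :
    T.interior ⊆ Ω := by
  rw [← h.regular, ← interior_closedInterior hn, h.cover]
  exact interior_mono (subset_biUnion_of_mem (u := fun T : Macro n => T.closedInterior) hT)

lemma exists_mem_latticeInterior_of_notMem_boundaryVertices {x : E n} (hx : x ∈ vertices Th m)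
    (hxb : x ∉ boundaryVertices Th m) : ∃ T ∈ Th, x ∈ latticeInterior m T := by
  obtain ⟨T, hT, hxT⟩ := mem_iUnion₂.1 hx
  by_contra! hint
  exact hxb (mem_iUnion₂.2 ⟨T, hT, hxT, hint T hT⟩)

lemma one_le_baryCoord_of_mem_latticeInterior (hn : n ≠ 0) {z : E n}
    (hz : z ∈ latticeInterior m T) (k : Fin (n + 1)) : 1 ≤ 2 ^ m * baryCoord T k z := by
  obtain ⟨a, ha⟩ := mem_lattice_iff.1 hz.1 k
  have hpos : 0 < 2 ^ m * baryCoord T k z :=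
    mul_pos (by positivity) ((mem_interior_iff hn).1 hz.2 k)
  rw [ha] at hpos ⊢
  exact_mod_cast hpos

lemma mem_interior_of_hatFn_ne_zero (hn : n ≠ 0) {x z : E n} (hz : z ∈ latticeInterior m T)
    (hx : hatFn m T (x - z) ≠ 0) : x ∈ T.interior := by
  refine (mem_interior_iff hn).2 fun k => ?_
  have hz1 := one_le_baryCoord_of_mem_latticeInterior hn hz k
  have hle := neg_le_of_abs_le (abs_baryDir_le_wallSeminorm T k (x - z))
  rw [← baryCoord_sub] at hle
  have hlt := hatFn_ne_zero_iff.1 hx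
  refine pos_of_mul_pos_right (a := (2 : ℝ) ^ m) ?_ (by positivity)
  have hmul := mul_le_mul_of_nonneg_left hle (by positivity : (0 : ℝ) ≤ 2 ^ m)
  linarith

lemma vertexFn_nonneg (S : Set (Fin (n + 1) → E n)) (z x : E n) : 0 ≤ vertexFn S z x := by
  refine Real.sSup_nonneg ?_
  rintro _ ⟨t, -, w, hw, -, rfl⟩
  exact Finset.sum_nonneg fun k _ => mul_nonneg (hw.1 k)
    (indicator_nonneg (fun _ _ => zero_le_one) _)

lemma sum_smul_mem_closedInterior {t : Fin (n + 1) → E n} (ht : t ∈ refine m T.points)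
    {w : Fin (n + 1) → ℝ} (hw : w ∈ stdSimplex ℝ (Fin (n + 1))) :
    ∑ k, w k • t k ∈ T.closedInterior :=
  (convex_closedInterior T).sum_mem (fun k _ => hw.1 k) hw.2 fun k _ =>
    mem_of_mem_refine (convex_closedInterior T) T.point_mem_closedInterior ht k

lemma vertexFn_eq_of_mem_interior (hn : n = 2 ∨ n = 3) (h : IsMacroMesh Ω Th) (hT : T ∈ Th)
    {x z : E n} (hx : x ∈ T.interior) {c : ℝ}
    (hc : ∀ t ∈ refine m T.points, ∀ w ∈ stdSimplex ℝ (Fin (n + 1)), ∑ k, w k • t k = x →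
      ∑ k, w k * indicator {z} (fun _ => (1 : ℝ)) (t k) = c) :
    vertexFn (fineMesh Th m) z x = c := by
  have hn0 : n ≠ 0 := by omega
  rw [vertexFn, ← csSup_singleton c]
  congr 1
  refine Nonempty.subset_singleton_iff ?_ |>.1 ?_
  · have hw : (fun k => baryCoord T k x) ∈ stdSimplex ℝ (Fin (n + 1)) :=
      ⟨fun k => ((mem_interior_iff hn0).1 hx k).le, sum_baryCoord T x⟩
    obtain ⟨t, ht, w, hw, hsum⟩ := exists_mem_refine_combination hn T.points hw m
    rw [sum_baryCoord_smul] at hsum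
    exact ⟨_, t, mem_iUnion₂.2 ⟨T, hT, ht⟩, w, hw, hsum, rfl⟩
  · rintro _ ⟨t, ht, w, hw, rfl, rfl⟩
    obtain ⟨T', hT', ht⟩ := mem_iUnion₂.1 ht
    obtain rfl := h.eq_of_mem_interior hn0 hT hT' hx (sum_smul_mem_closedInterior ht hw)
    exact hc t ht w hw rfl

lemma vertexFn_eq_hatFn_of_mem_interior (hn : n = 2 ∨ n = 3) (h : IsMacroMesh Ω Th) (hT : T ∈ Th)
    {x z : E n} (hx : x ∈ T.interior) (hz : z ∈ lattice m T) :
    vertexFn (fineMesh Th m) z x = hatFn m T (x - z) :=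
  vertexFn_eq_of_mem_interior hn h hT hx fun t ht w hw hsum => by
    rw [← hsum, hatFn_combination_sub hn ht hz hw]

lemma vertexFn_eq_zero_of_mem_interior (hn : n = 2 ∨ n = 3) (h : IsMacroMesh Ω Th) (hT : T ∈ Th)
    {x z : E n} (hx : x ∈ T.interior) (hz : z ∉ lattice m T) :
    vertexFn (fineMesh Th m) z x = 0 :=
  vertexFn_eq_of_mem_interior hn h hT hx fun t ht w _ _ => Finset.sum_eq_zero fun k _ => by
    have hne : t k ∉ ({z} : Set (E n)) := fun hk => hz (hk ▸ mem_lattice_of_mem_refine hn ht k)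
    rw [indicator_of_notMem hne, mul_zero]

lemma vertexFn_eq_hatFn (hn : n = 2 ∨ n = 3) (h : IsMacroMesh Ω Th) (hT : T ∈ Th) {z : E n}
    (hz : z ∈ latticeInterior m T) (x : E n) :
    vertexFn (fineMesh Th m) z x = hatFn m T (x - z) := by
  have hn0 : n ≠ 0 := by omega
  by_cases hx : x ∈ T.interior
  · exact vertexFn_eq_hatFn_of_mem_interior hn h hT hx hz.1
  have hzero : hatFn m T (x - z) = 0 := of_not_not fun h' =>
    hx (mem_interior_of_hatFn_ne_zero hn0 hz h')
  rw [hzero]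
  refine le_antisymm (Real.sSup_nonpos ?_) (vertexFn_nonneg _ _ _)
  rintro _ ⟨t, ht, w, hw, rfl, rfl⟩
  obtain ⟨T', hT', ht⟩ := mem_iUnion₂.1 ht
  by_cases hk : ∃ k, t k = z
  · obtain ⟨k, rfl⟩ := hk
    obtain rfl := h.eq_of_mem_interior hn0 hT hT' hz.2
      (lattice_subset_closedInterior m T' (mem_lattice_of_mem_refine hn ht k))
    rw [← hatFn_combination_sub hn ht hz.1 hw, hzero]
  · push Not at hk
    refine (Finset.sum_eq_zero fun k _ => ?_).le
    rw [indicator_of_notMem (by exact hk k), mul_zero]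

lemma testFn_eq_hatFn (hn : n = 2 ∨ n = 3) (h : IsMacroMesh Ω Th) (hT : T ∈ Th) {z : E n}
    (hz : z ∈ latticeInterior m T) : testFn Th m z = hatFn m T := by
  ext y
  rw [testFn, vertexFn_eq_hatFn hn h hT hz, add_sub_cancel_right]

lemma mem_overlap_iff {φ : E n → ℝ} {δ y : E n} : y ∈ overlap φ δ ↔ φ y ≠ 0 ∧ φ (y - δ) ≠ 0 :=
  Iff.rfl

lemma add_mem_interior_of_mem_overlap (hn : n ≠ 0) {x δ y : E n}
    (hx : x ∈ latticeInterior m T ∨ x + δ ∈ latticeInterior m T)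
    (hy : y ∈ overlap (hatFn m T) δ) : x + y ∈ T.interior := by
  rw [mem_overlap_iff] at hy
  rcases hx with hx | hx
  · exact mem_interior_of_hatFn_ne_zero hn hx (by rw [add_sub_cancel_left]; exact hy.1)
  · exact mem_interior_of_hatFn_ne_zero hn hx (by rw [add_sub_add_left_eq_sub]; exact hy.2)

/-- `δ` is a difference of two points of `lattice m T` whose hat functions overlap. For elements
with an interior lattice point this describes `translations Th m T` without reference to the rest
of the mesh. -/
def IsNeighbor (m : ℕ) (T : Macro n) (δ : E n) : Prop :=
  (∃ y ∈ lattice m T, ∃ y' ∈ lattice m T, δ = y' - y) ∧ (overlap (hatFn m T) δ).Nonempty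

lemma IsNeighbor.neg {δ : E n} (h : IsNeighbor m T δ) : IsNeighbor m T (-δ) := by
  obtain ⟨⟨y, hy, y', hy', rfl⟩, v, hv, hv'⟩ := h
  refine ⟨⟨y', hy', y, hy, neg_sub _ _⟩, v - (y' - y), hv', ?_⟩
  rwa [Function.mem_support, shift, sub_neg_eq_add, sub_add_cancel]

lemma IsNeighbor.two_pow_mul_wallSeminorm_lt {δ : E n} (h : IsNeighbor m T δ) :
    2 ^ m * wallSeminorm T δ < 2 := by
  obtain ⟨-, v, hv, hv'⟩ := h
  have htri : wallSeminorm T δ ≤ wallSeminorm T v + wallSeminorm T (v - δ) := by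
    simpa using map_sub_le_add (wallSeminorm T) v (v - δ)
  have hlt := add_lt_add (hatFn_ne_zero_iff.1 hv) (hatFn_ne_zero_iff.1 hv')
  rw [← mul_add] at hlt
  calc 2 ^ m * wallSeminorm T δ ≤ 2 ^ m * (wallSeminorm T v + wallSeminorm T (v - δ)) := by gcongr
    _ < 2 := by linarith

-- Scaled by `2 ^ m`, the barycentric coordinates of `z` are integers `≥ 1`, and those of `δ` are
-- integers `> -2`.
lemma IsNeighbor.add_mem_lattice (hn : n ≠ 0) {δ z : E n} (h : IsNeighbor m T δ)
    (hz : z ∈ latticeInterior m T) : z + δ ∈ lattice m T := by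
  refine mem_lattice_iff.2 fun k => ?_
  have hlt := h.two_pow_mul_wallSeminorm_lt
  obtain ⟨⟨y, hy, y', hy', rfl⟩, -⟩ := h
  have hz1 := one_le_baryCoord_of_mem_latticeInterior hn hz k
  obtain ⟨a, ha⟩ := mem_lattice_iff.1 hz.1 k
  obtain ⟨b, hb⟩ := mem_lattice_iff.1 hy k
  obtain ⟨b', hb'⟩ := mem_lattice_iff.1 hy' k
  obtain ⟨d, hd⟩ : ∃ d : ℤ, 2 ^ m * baryCoord T k (z + (y' - y)) = d :=
    ⟨a + b' - b, by
      push_cast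
      rw [baryCoord_add, ← baryCoord_sub, mul_add, mul_sub, ha, hb, hb', add_sub_assoc]⟩
  have hle := mul_le_mul_of_nonneg_left
    (neg_le_of_abs_le (abs_baryDir_le_wallSeminorm T k (y' - y))) (by positivity : (0 : ℝ) ≤ 2 ^ m)
  have hgt : -1 < d := by
    have hgt' : (-1 : ℝ) < d := by
      rw [← hd, baryCoord_add, mul_add]
      linarith
    exact_mod_cast hgt'
  lift d to ℕ using by omega
  exact ⟨d, by rw [hd, Int.cast_natCast]⟩

lemma isNeighbor_sub_of_vertexFn_ne_zero (hn : n = 2 ∨ n = 3) (h : IsMacroMesh Ω Th) (hT : T ∈ Th)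
    {p x x' : E n} (hx : x ∈ latticeInterior m T) (hp : vertexFn (fineMesh Th m) x p ≠ 0)
    (hp' : vertexFn (fineMesh Th m) x' p ≠ 0) : IsNeighbor m T (x' - x) := by
  rw [vertexFn_eq_hatFn hn h hT hx] at hp
  have hpT : p ∈ T.interior := mem_interior_of_hatFn_ne_zero (by omega) hx hp
  have hx' : x' ∈ lattice m T := of_not_not fun hx' =>
    hp' (vertexFn_eq_zero_of_mem_interior hn h hT hpT hx')
  rw [vertexFn_eq_hatFn_of_mem_interior hn h hT hpT hx'] at hp'
  refine ⟨⟨x, hx.1, x', hx', rfl⟩, p - x, hp, ?_⟩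
  rwa [Function.mem_support, shift, sub_sub_sub_cancel_right]

lemma mem_translations_iff_isNeighbor (hn : n = 2 ∨ n = 3) (h : IsMacroMesh Ω Th) (hT : T ∈ Th)
    (hne : (latticeInterior m T).Nonempty) {δ : E n} :
    δ ∈ translations Th m T ↔ IsNeighbor m T δ := by
  constructor
  · rintro ⟨x, hx, x', -, rfl, p, hp, hp'⟩
    exact isNeighbor_sub_of_vertexFn_ne_zero hn h hT hx hp hp'
  · intro hδ
    have hn0 : n ≠ 0 := by omega
    obtain ⟨z, hz⟩ := hne
    have hz' := hδ.add_mem_lattice hn0 hz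
    obtain ⟨-, v, hv⟩ := hδ
    have hzv : z + v ∈ T.interior := add_mem_interior_of_mem_overlap hn0 (Or.inl hz) hv
    rw [mem_overlap_iff] at hv
    refine ⟨z, hz, z + δ, mem_iUnion₂.2 ⟨T, hT, hz'⟩, (add_sub_cancel_left _ _).symm, z + v, ?_, ?_⟩
    · rw [Function.mem_support, vertexFn_eq_hatFn hn h hT hz, add_sub_cancel_left]
      exact hv.1
    · rw [Function.mem_support, vertexFn_eq_hatFn_of_mem_interior hn h hT hzv hz',
        add_sub_add_left_eq_sub]
      exact hv.2

end VertexFn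

/-! ### Matrix entries as values of stencil functions -/

lemma gradient_eq_zero_of_nonneg {f : E n → ℝ} (hf : ∀ x, 0 ≤ f x) {x : E n} (hx : f x = 0) :
    gradient f x = 0 := by
  have hmin : IsLocalMin f x := Filter.Eventually.of_forall fun y => hx.trans_le (hf y)
  rw [gradient, hmin.fderiv_eq_zero, map_zero]

lemma gradient_shift (f : E n → ℝ) (a x : E n) : gradient (shift f a) x = gradient f (x - a) := by
  rw [gradient, gradient, ← fderiv_comp_sub]
  rfl

lemma flux_zero_left (M : Matrix (Fin n) (Fin n) ℝ) (r : E n) : flux M 0 r = 0 := by simp [flux]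

lemma flux_zero_right (M : Matrix (Fin n) (Fin n) ℝ) (p : E n) : flux M p 0 = 0 := by simp [flux]

lemma ne_zero_of_flux_gradient_ne_zero {f g : E n → ℝ} (hf : ∀ x, 0 ≤ f x) (hg : ∀ x, 0 ≤ g x)
    {M : Matrix (Fin n) (Fin n) ℝ} {x y : E n} (h : flux M (gradient f x) (gradient g y) ≠ 0) :
    f x ≠ 0 ∧ g y ≠ 0 := by
  constructor
  · refine mt (fun hx => ?_) h
    rw [gradient_eq_zero_of_nonneg hf hx, flux_zero_left]
  · refine mt (fun hy => ?_) h
    rw [gradient_eq_zero_of_nonneg hg hy, flux_zero_right]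

lemma stencilFn_eq_integral {φ : E n → ℝ} (hφ : ∀ x, 0 ≤ φ x)
    (K : E n → Matrix (Fin n) (Fin n) ℝ) (δ x : E n) :
    stencilFn K φ δ x = ∫ y, flux (K (x + y)) (gradient φ (y - δ)) (gradient φ y) := by
  simp only [stencilFn, gradient_shift]
  refine setIntegral_eq_integral_of_forall_compl_eq_zero fun y hy => ?_
  exact of_not_not fun hne => hy (ne_zero_of_flux_gradient_ne_zero hφ hφ hne).symm

section TrueMatrix

variable {Ω : Set (E n)} {Th : Set (Macro n)} {m : ℕ} {T : Macro n} {i j : vertices Th m}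

lemma trueMatrix_eq_zero (hn : n = 2 ∨ n = 3) (h : IsMacroMesh Ω Th) (hT : T ∈ Th)
    (K : E n → Matrix (Fin n) (Fin n) ℝ)
    (hij : i.1 ∈ latticeInterior m T ∨ j.1 ∈ latticeInterior m T)
    (hN : ¬ IsNeighbor m T (j.1 - i.1)) : trueMatrix Ω Th m K i j = 0 := by
  refine integral_eq_zero_of_ae (Filter.Eventually.of_forall fun x => ?_)
  by_contra hne
  obtain ⟨hj0, hi0⟩ :=
    ne_zero_of_flux_gradient_ne_zero (vertexFn_nonneg _ _) (vertexFn_nonneg _ _) hne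
  rcases hij with hi | hj
  · exact hN (isNeighbor_sub_of_vertexFn_ne_zero hn h hT hi hi0 hj0)
  · rw [← neg_sub] at hN
    exact hN (isNeighbor_sub_of_vertexFn_ne_zero hn h hT hj hj0 hi0).neg

lemma mem_interior_of_vertexFn_ne_zero (hn : n = 2 ∨ n = 3) (h : IsMacroMesh Ω Th) (hT : T ∈ Th)
    {x z : E n} (hz : z ∈ latticeInterior m T) (hx : vertexFn (fineMesh Th m) z x ≠ 0) :
    x ∈ T.interior :=
  mem_interior_of_hatFn_ne_zero (by omega) hz (by rwa [← vertexFn_eq_hatFn hn h hT hz])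

lemma gradient_vertexFn (hn : n = 2 ∨ n = 3) (h : IsMacroMesh Ω Th) (hT : T ∈ Th) {x z : E n}
    (hx : x ∈ T.interior) (hz : z ∈ lattice m T) :
    gradient (vertexFn (fineMesh Th m) z) x = gradient (hatFn m T) (x - z) := by
  have heq : vertexFn (fineMesh Th m) z =ᶠ[nhds x] shift (hatFn m T) z := by
    filter_upwards [(isOpen_interior_simplex (by omega) T).mem_nhds hx] with y hy
    exact vertexFn_eq_hatFn_of_mem_interior hn h hT hy hz
  rw [← gradient_shift, gradient, gradient, heq.fderiv_eq]

lemma flux_gradient_vertexFn (hn : n = 2 ∨ n = 3) (h : IsMacroMesh Ω Th) (hT : T ∈ Th)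
    (M : Matrix (Fin n) (Fin n) ℝ) (hij : i.1 ∈ latticeInterior m T ∨ j.1 ∈ latticeInterior m T)
    (hi : i.1 ∈ lattice m T) (hj : j.1 ∈ lattice m T) (x : E n) :
    flux M (gradient (vertexFn (fineMesh Th m) j) x) (gradient (vertexFn (fineMesh Th m) i) x) =
      flux M (gradient (hatFn m T) (x - j)) (gradient (hatFn m T) (x - i)) := by
  by_cases hx : x ∈ T.interior
  · rw [gradient_vertexFn hn h hT hx hi, gradient_vertexFn hn h hT hx hj]
  trans 0
  · by_contra hne
    obtain ⟨hj0, hi0⟩ :=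
      ne_zero_of_flux_gradient_ne_zero (vertexFn_nonneg _ _) (vertexFn_nonneg _ _) hne
    exact hx (hij.elim (mem_interior_of_vertexFn_ne_zero hn h hT · hi0)
      (mem_interior_of_vertexFn_ne_zero hn h hT · hj0))
  · by_contra hne
    obtain ⟨hj0, hi0⟩ := ne_zero_of_flux_gradient_ne_zero (hatFn_nonneg m T) (hatFn_nonneg m T)
      (Ne.symm hne)
    exact hx (hij.elim (mem_interior_of_hatFn_ne_zero (by omega) · hi0)
      (mem_interior_of_hatFn_ne_zero (by omega) · hj0))

lemma trueMatrix_eq_stencilFn (hn : n = 2 ∨ n = 3) (h : IsMacroMesh Ω Th) (hT : T ∈ Th)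
    (K : E n → Matrix (Fin n) (Fin n) ℝ)
    (hij : i.1 ∈ latticeInterior m T ∨ j.1 ∈ latticeInterior m T)
    (hi : i.1 ∈ lattice m T) (hj : j.1 ∈ lattice m T) :
    trueMatrix Ω Th m K i j = stencilFn K (hatFn m T) (j.1 - i.1) i.1 := by
  have hΩ : trueMatrix Ω Th m K i j = ∫ x, flux (K x) (gradient (vertexFn (fineMesh Th m) j) x)
      (gradient (vertexFn (fineMesh Th m) i) x) := by
    refine setIntegral_eq_integral_of_forall_compl_eq_zero fun x hx => of_not_not fun hne => hx ?_
    obtain ⟨hj0, hi0⟩ :=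
      ne_zero_of_flux_gradient_ne_zero (vertexFn_nonneg _ _) (vertexFn_nonneg _ _) hne
    exact h.interior_subset (by omega) hT (hij.elim
      (mem_interior_of_vertexFn_ne_zero hn h hT · hi0)
      (mem_interior_of_vertexFn_ne_zero hn h hT · hj0))
  rw [hΩ, stencilFn_eq_integral (hatFn_nonneg m T), ← integral_add_left_eq_self _ i.1]
  refine integral_congr_ae (Filter.Eventually.of_forall fun y => ?_)
  dsimp only
  rw [flux_gradient_vertexFn hn h hT _ hij hi hj, add_sub_cancel_left, sub_sub_eq_add_sub, add_comm]

lemma trueMatrix_sub_surrogateMatrix (hn : n = 2 ∨ n = 3) (h : IsMacroMesh Ω Th)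
    (K : E n → Matrix (Fin n) (Fin n) ℝ) (c : Macro n → E n) (P : ProjectionFamily Th m c)
    (i j : vertices Th m) :
    (trueMatrix Ω Th m K - surrogateMatrix Ω Th m K c P) i j = 0 ∨
      ∃ T ∈ Th, (i.1 ∈ latticeInterior m T ∨ j.1 ∈ latticeInterior m T) ∧
        i.1 ∈ lattice m T ∧ j.1 - i.1 ∈ translations Th m T ∧
        (trueMatrix Ω Th m K - surrogateMatrix Ω Th m K c P) i j =
          stencilFn K (hatFn m T) (j.1 - i.1) i.1 -
            surrogateStencilFn Th m K c P T (j.1 - i.1) i.1 := by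
  have htrans {T : Macro n} (hT : T ∈ Th)
      (hij : i.1 ∈ latticeInterior m T ∨ j.1 ∈ latticeInterior m T) :
      j.1 - i.1 ∈ translations Th m T ↔ IsNeighbor m T (j.1 - i.1) :=
    mem_translations_iff_isNeighbor hn h hT (hij.elim (⟨_, ·⟩) (⟨_, ·⟩))
  rw [Matrix.sub_apply, surrogateMatrix]
  split_ifs with hb hex
  · exact Or.inl (sub_self _)
  · right
    obtain ⟨hT, htr, hij⟩ := hex.choose_spec
    have hN := (htrans hT hij).1 htr
    have hn0 : n ≠ 0 := by omega
    have hi : i.1 ∈ lattice m hex.choose := hij.elim (·.1) fun hj => by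
      simpa using hN.neg.add_mem_lattice hn0 hj
    have hj : j.1 ∈ lattice m hex.choose := hij.elim (fun hi => by
      simpa using hN.add_mem_lattice hn0 hi) (·.1)
    exact ⟨hex.choose, hT, hij, hi, htr, by rw [trueMatrix_eq_stencilFn hn h hT K hij hi hj]⟩
  · left
    obtain ⟨T, hT, hij⟩ : ∃ T ∈ Th, i.1 ∈ latticeInterior m T ∨ j.1 ∈ latticeInterior m T := by
      by_contra! hint
      refine hb ⟨of_not_not fun hi => ?_, of_not_not fun hj => ?_⟩
      · obtain ⟨T, hT, hiT⟩ := exists_mem_latticeInterior_of_notMem_boundaryVertices i.2 hi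
        exact (hint T hT).1 hiT
      · obtain ⟨T, hT, hjT⟩ := exists_mem_latticeInterior_of_notMem_boundaryVertices j.2 hj
        exact (hint T hT).2 hjT
    rw [trueMatrix_eq_zero hn h hT K hij fun hN => hex ⟨T, hT, (htrans hT hij).2 hN, hij⟩, sub_zero]

end TrueMatrix

/-! ### Domains of stencil functions -/

lemma isOpen_overlap {φ : E n → ℝ} (hφ : Continuous φ) (δ : E n) : IsOpen (overlap φ δ) :=
  hφ.isOpen_support.inter (hφ.comp (continuous_id.sub continuous_const)).isOpen_support

lemma mem_stencilDomain (hn : n ≠ 0) {m : ℕ} {T : Macro n} {x δ z : E n}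
    (hx : x ∈ latticeInterior m T ∨ x + δ ∈ latticeInterior m T) (hxl : x ∈ lattice m T)
    (hz : z ∈ latticeInterior m T) : x ∈ stencilDomain T (hatFn m T) δ := by
  have hseg : x ∈ closure (openSegment ℝ x z) := by
    rw [closure_openSegment]
    exact left_mem_segment ℝ x z
  refine closure_mono ?_ hseg
  rintro p ⟨a, b, ha, hb, hab, rfl⟩
  constructor
  · have hzT := hz.2
    rw [← interior_closedInterior hn] at hzT ⊢
    exact (convex_closedInterior T).combo_self_interior_mem_interior
      (lattice_subset_closedInterior m T hxl) hzT ha.le hb hab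
  · intro y hy
    have hxy := add_mem_interior_of_mem_overlap hn hx hy
    have hzy := add_mem_interior_of_mem_overlap hn (Or.inl hz) hy
    have hsum : a • x + b • z + y = a • (x + y) + b • (z + y) := by
      rw [smul_add, smul_add, add_add_add_comm, ← add_smul, hab, one_smul]
    rw [hsum]
    exact convex_interior_simplex hn T hxy hzy ha.le hb.le hab

lemma add_mem_interior_of_mem_stencilDomain (hn : n ≠ 0) {T : Macro n} {φ : E n → ℝ}
    (hφ : Continuous φ) {x δ y : E n} (hx : x ∈ stencilDomain T φ δ) (hy : y ∈ overlap φ δ) :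
    x + y ∈ T.interior := by
  have hmem : ∀ y ∈ overlap φ δ, x + y ∈ T.closedInterior := by
    intro y hy
    rw [← closure_interior_simplex hn]
    exact map_mem_closure (f := fun x => x + y) (continuous_id.add continuous_const) hx
      fun z hz => hz.2 y hy
  rw [← interior_closedInterior hn, mem_interior]
  refine ⟨(fun z => z - x) ⁻¹' overlap φ δ, fun z hz => ?_,
    (isOpen_overlap hφ δ).preimage (continuous_id.sub continuous_const), ?_⟩
  · simpa using hmem _ hz
  · simpa using hy

/-! ### Taylor polynomials -/

/-- The polynomial functions of total degree at most `r`. -/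
def polyFun (n r : ℕ) : Submodule ℝ (E n → ℝ) :=
  (MvPolynomial.restrictTotalDegree (Fin n) ℝ r).map
    (LinearMap.pi fun x : E n => (MvPolynomial.aeval (R := ℝ) fun a => x a).toLinearMap)

lemma mem_polyFun_iff {r : ℕ} {f : E n → ℝ} :
    f ∈ polyFun n r ↔ ∃ p : MvPolynomial (Fin n) ℝ, p.totalDegree ≤ r ∧
      ∀ x, f x = MvPolynomial.eval (fun a => x a) p := by
  simp only [polyFun, Submodule.mem_map, MvPolynomial.mem_restrictTotalDegree, funext_iff,
    eq_comm, LinearMap.pi_apply, AlgHom.toLinearMap_apply, MvPolynomial.aeval_eq_eval]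

lemma polyFun_mono {r q : ℕ} (h : r ≤ q) : polyFun n r ≤ polyFun n q := fun _ hf =>
  let ⟨p, hp, hfp⟩ := mem_polyFun_iff.1 hf
  mem_polyFun_iff.2 ⟨p, hp.trans h, hfp⟩

lemma prod_coord_sub_mem_polyFun {k : ℕ} (s : Fin k → Fin n) (x₀ : E n) :
    (fun x : E n => ∏ l, (x - x₀) (s l)) ∈ polyFun n k := by
  let p (l : Fin k) : MvPolynomial (Fin n) ℝ :=
    MvPolynomial.X (s l) - MvPolynomial.C (x₀ (s l))
  have hp (l : Fin k) : (p l).totalDegree ≤ 1 :=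
    (MvPolynomial.totalDegree_sub _ _).trans (by simp)
  refine mem_polyFun_iff.2 ⟨∏ l, p l, ?_, by simp [p]⟩
  calc (∏ l, p l).totalDegree ≤ ∑ l, (p l).totalDegree := MvPolynomial.totalDegree_finsetProd _ _
    _ ≤ ∑ _l : Fin k, 1 := Finset.sum_le_sum fun l _ => hp l
    _ = k := by simp

/-- The Taylor polynomial of degree `r` at `x₀` with prescribed partial derivatives `c k s` there.
The sum over all sequences `s` of `k` directions counts each multi-index of order `k` with its
multinomial multiplicity, so that `1 / k!` is the right weight. -/
def taylorPoly (r : ℕ) (x₀ : E n) (c : ∀ k, (Fin k → Fin n) → ℝ) (x : E n) : ℝ :=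
  ∑ k ∈ Finset.range (r + 1),
    (k.factorial : ℝ)⁻¹ * ∑ s : Fin k → Fin n, (∏ l, (x - x₀) (s l)) * c k s

lemma taylorPoly_mem_polyFun (r : ℕ) (x₀ : E n) (c : ∀ k, (Fin k → Fin n) → ℝ) :
    taylorPoly r x₀ c ∈ polyFun n r := by
  have e : taylorPoly r x₀ c = ∑ k ∈ Finset.range (r + 1), (k.factorial : ℝ)⁻¹ •
      ∑ s : Fin k → Fin n, c k s • fun x : E n => ∏ l, (x - x₀) (s l) := by
    ext x
    simp only [taylorPoly, Finset.sum_apply, Pi.smul_apply, smul_eq_mul, mul_comm (c _ _)]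
  rw [e]
  exact Submodule.sum_mem _ fun k hk => Submodule.smul_mem _ _ <|
    Submodule.sum_mem _ fun s _ => Submodule.smul_mem _ _ <|
      polyFun_mono (Finset.mem_range_succ_iff.1 hk) (prod_coord_sub_mem_polyFun s x₀)

lemma iteratedDeriv_comp_add_smul {F : Type*} [NormedAddCommGroup F] [NormedSpace ℝ F]
    {f : F → ℝ} {k : ℕ} (hf : ContDiff ℝ k f) (x d : F) (t : ℝ) :
    iteratedDeriv k (fun t : ℝ => f (x + t • d)) t =
      iteratedFDeriv ℝ k f (x + t • d) fun _ => d := by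
  have e : (fun t : ℝ => f (x + t • d)) =
      (fun z => f (x + z)) ∘ ContinuousLinearMap.toSpanSingleton ℝ d := by
    ext t; simp
  have hfx : ContDiff ℝ k fun z => f (x + z) := hf.comp (contDiff_const.add contDiff_id)
  rw [iteratedDeriv_eq_iteratedFDeriv, e, ContinuousLinearMap.iteratedFDeriv_comp_right _ hfx _
    le_rfl, iteratedFDeriv_comp_add_left']
  simp [ContinuousMultilinearMap.compContinuousLinearMap_apply]

lemma iteratedFDeriv_apply_const {k : ℕ} (f : E n → ℝ) (x d : E n) :
    iteratedFDeriv ℝ k f x (fun _ => d) =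
      ∑ s : Fin k → Fin n, (∏ l, d (s l)) * partialDeriv s f x := by
  have hd : d = ∑ a, d a • EuclideanSpace.single a (1 : ℝ) := by
    ext b
    simp [Finset.sum_apply, Pi.single_apply]
  conv_lhs => rw [hd]
  rw [ContinuousMultilinearMap.map_sum]
  refine Finset.sum_congr rfl fun s _ => ?_
  rw [ContinuousMultilinearMap.map_smul_univ, smul_eq_mul, partialDeriv]

lemma abs_sum_prod_coord_mul_le {k : ℕ} {d : E n} {H M : ℝ} (hd : ‖d‖ ≤ H)
    {c : (Fin k → Fin n) → ℝ} (hc : ∀ s, |c s| ≤ M) :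
    |∑ s : Fin k → Fin n, (∏ l, d (s l)) * c s| ≤ n ^ k * H ^ k * M := by
  have hprod (s : Fin k → Fin n) : |∏ l, d (s l)| ≤ H ^ k := by
    calc |∏ l, d (s l)| = ∏ l, |d (s l)| := Finset.abs_prod _ _
      _ ≤ ∏ _l : Fin k, H := Finset.prod_le_prod (fun _ _ => abs_nonneg _)
          fun l _ => (PiLp.norm_apply_le d (s l)).trans hd
      _ = H ^ k := by simp
  have hH : 0 ≤ H := (norm_nonneg d).trans hd
  calc |∑ s : Fin k → Fin n, (∏ l, d (s l)) * c s|
      ≤ ∑ s : Fin k → Fin n, |(∏ l, d (s l)) * c s| := Finset.abs_sum_le_sum_abs _ _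
    _ ≤ ∑ _s : Fin k → Fin n, H ^ k * M := Finset.sum_le_sum fun s _ => by
        rw [abs_mul]
        exact mul_le_mul (hprod s) (hc s) (abs_nonneg _) (by positivity)
    _ = n ^ k * H ^ k * M := by simp; ring

lemma abs_sub_taylorPoly_le {r : ℕ} {f : E n → ℝ} (hf : ContDiff ℝ (r + 1) f) {x₀ x : E n}
    {H M : ℝ} (hH : ‖x - x₀‖ ≤ H)
    (hM : ∀ z ∈ segment ℝ x₀ x, ∀ s : Fin (r + 1) → Fin n, |partialDeriv s f z| ≤ M) :
    |f x - taylorPoly r x₀ (fun _ s => partialDeriv s f x₀) x| ≤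
      n ^ (r + 1) * H ^ (r + 1) * M := by
  have hderiv {k : ℕ} (hk : k ≤ r + 1) (t : ℝ) :
      iteratedDeriv k (fun t : ℝ => f (x₀ + t • (x - x₀))) t = ∑ s : Fin k → Fin n,
        (∏ l, (x - x₀) (s l)) * partialDeriv s f (x₀ + t • (x - x₀)) := by
    rw [iteratedDeriv_comp_add_smul (hf.of_le (mod_cast hk)), iteratedFDeriv_apply_const]
  have hline : ContDiff ℝ (r + 1) fun t : ℝ => f (x₀ + t • (x - x₀)) :=
    hf.comp (contDiff_const.add (contDiff_id.smul contDiff_const))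
  obtain ⟨t, ht, hlagrange⟩ := taylor_mean_remainder_lagrange_iteratedDeriv (n := r)
    (zero_ne_one (α := ℝ)) (mod_cast hline.contDiffOn)
  rw [uIoo_of_le zero_le_one] at ht
  have htaylor : taylorWithinEval (fun t : ℝ => f (x₀ + t • (x - x₀))) r (uIcc 0 1) 0 1 =
      taylorPoly r x₀ (fun _ s => partialDeriv s f x₀) x := by
    rw [taylor_within_apply]
    refine Finset.sum_congr rfl fun k hk => ?_
    have hk : k ≤ r + 1 := (Finset.mem_range.1 hk).le
    rw [iteratedDerivWithin_eq_iteratedDeriv (uniqueDiffOn_uIcc zero_ne_one)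
      (hline.contDiffAt.of_le (mod_cast hk)) (by simp), hderiv hk]
    simp
  rw [htaylor, one_smul, add_sub_cancel, sub_zero, one_pow, mul_one, hderiv le_rfl] at hlagrange
  rw [hlagrange, abs_div, Nat.abs_cast]
  refine (div_le_self (abs_nonneg _) (mod_cast (r + 1).factorial_pos)).trans ?_
  refine abs_sum_prod_coord_mul_le hH fun s => hM _ ?_ s
  rw [segment_eq_image']
  exact ⟨t, ⟨ht.1.le, ht.2.le⟩, rfl⟩

/-! ### Mollification and weak derivatives -/

lemma iteratedFDeriv_convolution_apply {F : Type*} [NormedAddCommGroup F] [NormedSpace ℝ F]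
    [MeasurableSpace F] [BorelSpace F] {μ : Measure F} [SFinite μ] [μ.IsAddLeftInvariant]
    {w θ : F → ℝ} (hw : LocallyIntegrable w μ) (hc : HasCompactSupport θ) {k : ℕ}
    (hθ : ContDiff ℝ k θ) (x : F) (d : Fin k → F) :
    iteratedFDeriv ℝ k (w ⋆[ContinuousLinearMap.lsmul ℝ ℝ, μ] θ) x d =
      (w ⋆[ContinuousLinearMap.lsmul ℝ ℝ, μ] fun z => iteratedFDeriv ℝ k θ z d) x := by
  induction k generalizing x with
  | zero => simp
  | succ k ih =>
    have hk : ContDiff ℝ k θ := hθ.of_le (mod_cast k.le_succ)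
    have hcd : HasCompactSupport fun z => iteratedFDeriv ℝ k θ z (Fin.tail d) :=
      (hc.iteratedFDeriv (𝕜 := ℝ) k).comp_left
        (g := fun f : ContinuousMultilinearMap ℝ (fun _ : Fin k => F) ℝ => f (Fin.tail d)) rfl
    have hθk : ContDiff ℝ 1 (iteratedFDeriv ℝ k θ) :=
      hθ.iteratedFDeriv_right (by rw [add_comm]; norm_cast)
    have hθd : ContDiff ℝ 1 fun z => iteratedFDeriv ℝ k θ z (Fin.tail d) :=
      (ContinuousMultilinearMap.apply ℝ (fun _ : Fin k => F) ℝ (Fin.tail d)).contDiff.comp hθk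
    have hwθ : ContDiff ℝ (k + 1) (w ⋆[ContinuousLinearMap.lsmul ℝ ℝ, μ] θ) :=
      mod_cast hc.contDiff_convolution_right (n := k + 1) _ hw (mod_cast hθ)
    have hdiff : DifferentiableAt ℝ
        (iteratedFDeriv ℝ k (w ⋆[ContinuousLinearMap.lsmul ℝ ℝ, μ] θ)) x :=
      (hwθ.iteratedFDeriv_right (m := 1) (by rw [add_comm])).differentiable one_ne_zero x
    rw [hdiff.iteratedFDeriv_succ_apply_left', funext fun y => ih hk y (Fin.tail d),
      (hcd.hasFDerivAt_convolution_right _ hw hθd x).fderiv,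
      convolution_precompR_apply _ hw (hcd.fderiv ℝ) (hθd.continuous_fderiv one_ne_zero)]
    congr 1
    ext z
    exact ((hθk.differentiable one_ne_zero z).iteratedFDeriv_succ_apply_left').symm

lemma partialDeriv_comp_sub_left {k : ℕ} (s : Fin k → Fin n) {θ : E n → ℝ} (hθ : ContDiff ℝ k θ)
    (x y : E n) : partialDeriv s (fun y => θ (x - y)) y = (-1) ^ k * partialDeriv s θ (x - y) := by
  have e : (fun y => θ (x - y)) =
      fun y => (θ ∘ (-ContinuousLinearMap.id ℝ (E n))) (y - x) := by
    ext y; simp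
  have hneg : (fun l => (-ContinuousLinearMap.id ℝ (E n)) (EuclideanSpace.single (s l) (1 : ℝ))) =
      fun l => (-1 : ℝ) • EuclideanSpace.single (s l) (1 : ℝ) := by
    ext l; simp
  rw [partialDeriv, e, iteratedFDeriv_comp_sub, ContinuousLinearMap.iteratedFDeriv_comp_right _ hθ _
    le_rfl, ContinuousMultilinearMap.compContinuousLinearMap_apply, hneg,
    ContinuousMultilinearMap.map_smul_univ]
  simp [partialDeriv]

lemma integral_indicator_mul {X : Type*} [MeasurableSpace X] {μ : Measure X} {U : Set X}
    (hU : MeasurableSet U) (f g : X → ℝ) :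
    ∫ y, U.indicator f y * g y ∂μ = ∫ y in U, f y * g y ∂μ := by
  rw [← integral_indicator hU]
  exact integral_congr_ae (.of_forall fun y => (indicator_mul_left U f g).symm)

lemma IsWeakDeriv.partialDeriv_convolution {U : Set (E n)} (hU : MeasurableSet U) {k : ℕ}
    {s : Fin k → Fin n} {v g θ : E n → ℝ} (h : IsWeakDeriv U s v g)
    (hv : LocallyIntegrable (U.indicator v)) (hθ : ContDiff ℝ ∞ θ) {ε : ℝ}
    (hc : tsupport θ ⊆ Metric.closedBall 0 ε) {x : E n} (hx : Metric.closedBall x ε ⊆ U) :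
    partialDeriv s (U.indicator v ⋆ θ) x = (U.indicator g ⋆ θ) x := by
  have hθk : ContDiff ℝ k θ := hθ.of_le (mod_cast le_top)
  have hη : ContDiff ℝ ∞ (fun y => θ (x - y)) := hθ.comp (contDiff_const.sub contDiff_id)
  have hsupp : tsupport (fun y => θ (x - y)) ⊆ Metric.closedBall x ε := by
    refine closure_minimal (fun y hy => ?_) Metric.isClosed_closedBall
    have := hc (subset_tsupport θ hy)
    rwa [mem_closedBall_zero_iff, ← dist_eq_norm, dist_comm] at this
  have hcs : HasCompactSupport (fun y => θ (x - y)) :=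
    (isCompact_closedBall x ε).of_isClosed_subset (isClosed_tsupport _) hsupp
  have hcθ : HasCompactSupport θ :=
    (isCompact_closedBall 0 ε).of_isClosed_subset (isClosed_tsupport _) hc
  have hparts := h.2.2 _ hη hcs (hsupp.trans hx)
  simp only [partialDeriv_comp_sub_left s hθk, mul_left_comm (v _), integral_const_mul] at hparts
  rw [partialDeriv, iteratedFDeriv_convolution_apply hv hcθ hθk]
  simp only [convolution_def, ContinuousLinearMap.lsmul_apply, smul_eq_mul]
  rw [integral_indicator_mul hU, integral_indicator_mul hU]
  exact mul_left_cancel₀ (by positivity) hparts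

lemma abs_convolution_le {F : Type*} [NormedAddCommGroup F] [NormedSpace ℝ F]
    [MeasurableSpace F] [BorelSpace F] {μ : Measure F} [μ.IsAddLeftInvariant]
    [μ.IsNegInvariant] {w θ : F → ℝ} {G : ℝ}
    (hw : ∀ᵐ x ∂μ, |w x| ≤ G) (hθ : ∀ x, 0 ≤ θ x) (hint : ∫ x, θ x ∂μ = 1) (x : F) :
    |(w ⋆[ContinuousLinearMap.lsmul ℝ ℝ, μ] θ) x| ≤ G := by
  have hi : Integrable θ μ := .of_integral_ne_zero (by simp [hint])
  calc |(w ⋆[ContinuousLinearMap.lsmul ℝ ℝ, μ] θ) x|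
      ≤ ∫ y, G * θ (x - y) ∂μ := by
        rw [convolution_def, ← Real.norm_eq_abs]
        refine norm_integral_le_of_norm_le ((hi.comp_sub_left x).const_mul G) ?_
        filter_upwards [hw] with y hy
        rw [ContinuousLinearMap.lsmul_apply, norm_smul, Real.norm_of_nonneg (hθ _)]
        exact mul_le_mul_of_nonneg_right hy (hθ _)
    _ = G := by rw [integral_const_mul, integral_sub_left_eq_self, hint, mul_one]

lemma integrableOn_mul_of_tsupport_subset {U : Set (E n)} (hU : MeasurableSet U)
    {g η : E n → ℝ} (hg : LocallyIntegrableOn g U) (hη : Continuous η)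
    (hc : HasCompactSupport η) (hs : tsupport η ⊆ U) :
    IntegrableOn (fun x => g x * η x) U := by
  have hint : IntegrableOn (fun x => g x * η x) (tsupport η) :=
    (hg.integrableOn_compact_subset hs hc).mul_continuousOn hη.continuousOn hc
  refine hint.of_forall_sdiff_eq_zero hU fun x hx => ?_
  rw [image_eq_zero_of_notMem_tsupport hx.2, mul_zero]

lemma IsWeakDeriv.ae_eq {U : Set (E n)} (hU : IsOpen U) {k : ℕ} {s : Fin k → Fin n}
    {v g g' : E n → ℝ} (h : IsWeakDeriv U s v g) (h' : IsWeakDeriv U s v g') :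
    g =ᵐ[volume.restrict U] g' := by
  have hzero : ∀ᵐ x, x ∈ U → g x - g' x = 0 := by
    refine hU.ae_eq_zero_of_integral_contDiff_smul_eq_zero (h.2.1.sub h'.2.1) fun η hη hc hs => ?_
    have hint {f : E n → ℝ} (hf : LocallyIntegrableOn f U) : IntegrableOn (fun x => f x * η x) U :=
      integrableOn_mul_of_tsupport_subset hU.measurableSet hf hη.continuous hc hs
    have heq : ∫ x in U, g x * η x = ∫ x in U, g' x * η x :=
      mul_left_cancel₀ (by positivity) ((h.2.2 η hη hc hs).symm.trans (h'.2.2 η hη hc hs))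
    rw [← sub_eq_zero, ← integral_sub (hint h.2.1) (hint h'.2.1)] at heq
    rw [← setIntegral_eq_integral_of_forall_compl_eq_zero (s := U), ← heq]
    · simp only [smul_eq_mul, sub_mul, mul_comm (η _)]
    · intro x hx
      rw [image_eq_zero_of_notMem_tsupport fun hx' => hx (hs hx'), zero_smul]
  rw [Filter.EventuallyEq, ae_restrict_iff' hU.measurableSet]
  filter_upwards [hzero] with x hx hxU using sub_eq_zero.1 (hx hxU)

section MemSobolev

variable {U : Set (E n)} {k : ℕ} {v : E n → ℝ}

lemma MemSobolev.isWeakDeriv (h : MemSobolev k U v) {j : ℕ} (hj : j ≤ k) (s : Fin j → Fin n) :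
    IsWeakDeriv U s v (weakDeriv U s v) := by
  have hex : ∃ g, IsWeakDeriv U s v g := (h.2 j hj s).imp fun _ => And.left
  rw [weakDeriv, dif_pos hex]
  exact hex.choose_spec

lemma MemSobolev.memLp_weakDeriv (hU : IsOpen U) (h : MemSobolev k U v) {j : ℕ} (hj : j ≤ k)
    (s : Fin j → Fin n) : MemLp (weakDeriv U s v) ⊤ (volume.restrict U) :=
  let ⟨_, hg, hmem⟩ := h.2 j hj s
  hmem.ae_eq (hg.ae_eq hU (h.isWeakDeriv hj s))

lemma sobolevSeminorm_nonneg (k : ℕ) (U : Set (E n)) (v : E n → ℝ) :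
    0 ≤ sobolevSeminorm k U v := Real.iSup_nonneg fun _ => ENNReal.toReal_nonneg

lemma MemSobolev.ae_abs_weakDeriv_le (hU : IsOpen U) (h : MemSobolev k U v)
    (s : Fin k → Fin n) :
    ∀ᵐ x ∂(volume.restrict U), |weakDeriv U s v x| ≤ sobolevSeminorm k U v := by
  have hmem := h.memLp_weakDeriv hU le_rfl s
  have hle : lpNorm (weakDeriv U s v) ⊤ (volume.restrict U) ≤ sobolevSeminorm k U v := by
    rw [← toReal_eLpNorm hmem.1]
    exact le_ciSup (f := fun s => (eLpNorm (weakDeriv U s v) ⊤ (volume.restrict U)).toReal)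
      (finite_range _).bddAbove s
  filter_upwards [ae_le_lpNorm_exponent_top hmem] with x hx
  exact hx.trans hle

lemma locallyIntegrable_indicator (hU : MeasurableSet U) (hb : Bornology.IsBounded U)
    (hv : MemLp v ⊤ (volume.restrict U)) : LocallyIntegrable (U.indicator v) := by
  have : IsFiniteMeasure (volume.restrict U) := ⟨by simpa using hb.measure_lt_top⟩
  have hint : IntegrableOn v U := hv.integrable le_top
  exact ((integrable_indicator_iff hU).2 hint).locallyIntegrable

end MemSobolev

/-! ### Polynomial approximation in Sobolev spaces -/

lemma MemSobolev.abs_convolution_sub_taylorPoly_le {U : Set (E n)} (hU : IsOpen U)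
    (hb : Bornology.IsBounded U) {r : ℕ} {v θ : E n → ℝ} (h : MemSobolev (r + 1) U v)
    (hθ : ContDiff ℝ ∞ θ) (hθ0 : ∀ x, 0 ≤ θ x) (hθ1 : ∫ x, θ x = 1) {ε : ℝ}
    (hc : tsupport θ ⊆ Metric.closedBall 0 ε) {x₀ x : E n} {H : ℝ} (hH : ‖x - x₀‖ ≤ H)
    (hball : ∀ z ∈ segment ℝ x₀ x, Metric.closedBall z ε ⊆ U) :
    |(U.indicator v ⋆ θ) x -
        taylorPoly r x₀ (fun _ s => (U.indicator (weakDeriv U s v) ⋆ θ) x₀) x| ≤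
      n ^ (r + 1) * H ^ (r + 1) * sobolevSeminorm (r + 1) U v := by
  have hw := locallyIntegrable_indicator hU.measurableSet hb h.1
  have hcs : HasCompactSupport θ :=
    (isCompact_closedBall 0 ε).of_isClosed_subset (isClosed_tsupport _) hc
  have hderiv {k : ℕ} (hk : k ≤ r + 1) (s : Fin k → Fin n) {z : E n}
      (hz : z ∈ segment ℝ x₀ x) : partialDeriv s (U.indicator v ⋆ θ) z =
        (U.indicator (weakDeriv U s v) ⋆ θ) z :=
    (h.isWeakDeriv hk s).partialDeriv_convolution hU.measurableSet hw hθ hc (hball z hz)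
  have htaylor : taylorPoly r x₀ (fun _ s => (U.indicator (weakDeriv U s v) ⋆ θ) x₀) x =
      taylorPoly r x₀ (fun _ s => partialDeriv s (U.indicator v ⋆ θ) x₀) x := by
    refine Finset.sum_congr rfl fun k hk => ?_
    simp only [hderiv (Finset.mem_range.1 hk).le _ (left_mem_segment ℝ x₀ x)]
  rw [htaylor]
  refine abs_sub_taylorPoly_le ?_ hH fun z hz s => ?_
  · exact (hcs.contDiff_convolution_right _ hw hθ).of_le (mod_cast le_top)
  · rw [hderiv le_rfl s hz]
    refine abs_convolution_le ?_ hθ0 hθ1 z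
    have hbound := h.ae_abs_weakDeriv_le hU s
    rw [ae_restrict_iff' hU.measurableSet] at hbound
    filter_upwards [hbound] with y hy
    by_cases hyU : y ∈ U
    · rw [indicator_of_mem hyU]
      exact hy hyU
    · rw [indicator_of_notMem hyU, abs_zero]
      exact sobolevSeminorm_nonneg _ _ _

/-- A sequence of mollifiers, the `i`-th supported in the ball of radius `1 / (i + 1)`. -/
def mollifier (n i : ℕ) : ContDiffBump (0 : E n) where
  rIn := 1 / (i + 1) / 2
  rOut := 1 / (i + 1)
  rIn_pos := by positivity
  rIn_lt_rOut := half_lt_self (by positivity)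

lemma ae_tendsto_convolution_mollifier {w : E n → ℝ} (hw : LocallyIntegrable w) :
    ∀ᵐ x, Filter.Tendsto (fun i => (w ⋆ (mollifier n i).normed volume) x) Filter.atTop
      (nhds (w x)) := by
  have hrOut : Filter.Tendsto (fun i => (mollifier n i).rOut) Filter.atTop (nhds 0) :=
    tendsto_one_div_add_atTop_nhds_zero_nat
  have hratio : ∀ᶠ i in Filter.atTop, (mollifier n i).rOut ≤ 2 * (mollifier n i).rIn :=
    .of_forall fun i => le_of_eq (by simp only [mollifier]; ring)
  filter_upwards [ContDiffBump.ae_convolution_tendsto_right_of_locallyIntegrable hrOut hratio hw]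
    with x hx
  refine hx.congr fun i => ?_
  rw [convolution_lsmul_swap]
  simp only [convolution_def, ContinuousLinearMap.lsmul_apply, smul_eq_mul, mul_comm]

lemma MemSobolev.exists_tendsto_weakDeriv_convolution {U : Set (E n)} (hU : IsOpen U)
    (hne : U.Nonempty) (hb : Bornology.IsBounded U) {r : ℕ} {v : E n → ℝ}
    (h : MemSobolev r U v) :
    ∃ x₀ ∈ U, ∀ k ≤ r, ∀ s : Fin k → Fin n, Filter.Tendsto
      (fun i => (U.indicator (weakDeriv U s v) ⋆ (mollifier n i).normed volume) x₀) Filter.atTop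
      (nhds (U.indicator (weakDeriv U s v) x₀)) := by
  have hae : ∀ᵐ x : E n, ∀ k ≤ r, ∀ s : Fin k → Fin n, Filter.Tendsto
      (fun i => (U.indicator (weakDeriv U s v) ⋆ (mollifier n i).normed volume) x) Filter.atTop
      (nhds (U.indicator (weakDeriv U s v) x)) := by
    simp only [ae_all_iff]
    exact fun k hk s => ae_tendsto_convolution_mollifier
      (locallyIntegrable_indicator hU.measurableSet hb (h.memLp_weakDeriv hU hk s))
  obtain ⟨x₀, hx₀, hx₀U⟩ := (Measure.dense_of_ae hae).exists_mem_open hU hne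
  exact ⟨x₀, hx₀U, hx₀⟩

lemma tendsto_taylorPoly {ι : Type*} {l : Filter ι} {r : ℕ}
    {c : ι → ∀ k, (Fin k → Fin n) → ℝ} {c₀ : ∀ k, (Fin k → Fin n) → ℝ}
    (hc : ∀ k ≤ r, ∀ s, Filter.Tendsto (fun i => c i k s) l (nhds (c₀ k s))) (x₀ x : E n) :
    Filter.Tendsto (fun i => taylorPoly r x₀ (c i) x) l (nhds (taylorPoly r x₀ c₀ x)) :=
  tendsto_finsetSum _ fun k hk => (tendsto_finsetSum _ fun s _ =>
    (hc k (Finset.mem_range_succ_iff.1 hk) s).const_mul _).const_mul _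

lemma eventually_closedBall_subset_of_segment_subset {U : Set (E n)} (hU : IsOpen U)
    {x₀ x : E n} (hseg : segment ℝ x₀ x ⊆ U) :
    ∀ᶠ i : ℕ in Filter.atTop, ∀ z ∈ segment ℝ x₀ x,
      Metric.closedBall z (mollifier n i).rOut ⊆ U := by
  have hcomp : IsCompact (segment ℝ x₀ x) := by
    rw [segment_eq_image_lineMap]
    exact isCompact_Icc.image AffineMap.lineMap_continuous
  obtain ⟨δ, hδ, hδU⟩ := hcomp.exists_cthickening_subset_open hU hseg
  filter_upwards [tendsto_one_div_add_atTop_nhds_zero_nat.eventually_lt_const hδ] with i hi z hz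
  exact (Metric.closedBall_subset_cthickening hz _).trans
    ((Metric.cthickening_mono hi.le _).trans hδU)

/- The Taylor polynomials of the mollified function at a common Lebesgue point of all weak
derivatives converge to a polynomial with the weak derivatives as coefficients, and the Taylor
estimate passes to the limit. -/
theorem MemSobolev.exists_polyFun_ae_abs_sub_le {U : Set (E n)} (hU : IsOpen U)
    (hconv : Convex ℝ U) (hb : Bornology.IsBounded U) {r : ℕ} {v : E n → ℝ}
    (h : MemSobolev (r + 1) U v) :
    ∃ p ∈ polyFun n r, ∀ᵐ x ∂(volume.restrict U), |v x - p x| ≤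
      n ^ (r + 1) * Metric.diam U ^ (r + 1) * sobolevSeminorm (r + 1) U v := by
  rcases U.eq_empty_or_nonempty with rfl | hne
  · exact ⟨0, zero_mem _, by simp⟩
  obtain ⟨x₀, hx₀U, hx₀⟩ := h.exists_tendsto_weakDeriv_convolution hU hne hb
  refine ⟨taylorPoly r x₀ fun _ s => U.indicator (weakDeriv U s v) x₀,
    taylorPoly_mem_polyFun r x₀ _, ?_⟩
  rw [ae_restrict_iff' hU.measurableSet]
  filter_upwards [ae_tendsto_convolution_mollifier
    (locallyIntegrable_indicator hU.measurableSet hb h.1)] with x hx hxU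
  rw [indicator_of_mem hxU] at hx
  refine le_of_tendsto
    (hx.sub (tendsto_taylorPoly (fun k hk s => hx₀ k (hk.trans r.le_succ) s) x₀ x)).abs ?_
  filter_upwards [eventually_closedBall_subset_of_segment_subset hU
    (hconv.segment_subset hx₀U hxU)] with i hball
  exact h.abs_convolution_sub_taylorPoly_le hU hb (mollifier n i).contDiff_normed
    (mollifier n i).nonneg_normed (mollifier n i).integral_normed
    (mollifier n i).tsupport_normed_eq.subset
    (by rw [← dist_eq_norm]; exact Metric.dist_le_diam_of_mem hb hxU hx₀U) hball

/-! ### Correlation integrals -/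

/-- The correlation of a coefficient `k` with a weight `W`; the stencil functions are finite sums of
such integrals. -/
def corr (k W : E n → ℝ) (x : E n) : ℝ := ∫ y, k (x + y) * W y

section Corr

variable {k W : E n → ℝ}

lemma integrable_corr (hk : MemLp k ⊤ volume) (hW : Integrable W volume) (x : E n) :
    Integrable (fun y => k (x + y) * W y) volume :=
  hW.mul_of_top_right (hk.comp_measurePreserving (measurePreserving_add_left volume x))

lemma integrable_mul_of_hasCompactSupport (hk : Continuous k) (hW : Integrable W volume)
    (hc : HasCompactSupport W) : Integrable (fun y => k y * W y) volume := by
  rw [← integrableOn_iff_integrable_of_support_subset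
    ((Function.support_mul_subset_right k W).trans (subset_tsupport W))]
  exact hW.integrableOn.continuousOn_mul hk.continuousOn hc

lemma abs_corr_le {M : ℝ} (hM : ∀ᵐ x, |k x| ≤ M) (hW : Integrable W volume) (x : E n) :
    |corr k W x| ≤ M * ∫ y, |W y| := by
  have hx := measurePreserving_add_left (volume : Measure (E n)) x
  rw [← integral_const_mul, ← Real.norm_eq_abs]
  refine norm_integral_le_of_norm_le (hW.norm.const_mul M) ?_
  filter_upwards [hx.quasiMeasurePreserving.ae hM] with y hy
  rw [norm_mul, Real.norm_eq_abs]
  exact mul_le_mul_of_nonneg_right hy (abs_nonneg _)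

lemma continuous_corr_of_hasCompactSupport (hk : LocallyIntegrable k volume) (hW : Continuous W)
    (hc : HasCompactSupport W) : Continuous (corr k W) := by
  have hconv := (hc.comp_homeomorph (Homeomorph.neg (E n))).continuous_convolution_right
    (ContinuousLinearMap.lsmul ℝ ℝ) hk (hW.comp continuous_neg)
  convert hconv using 1
  ext x
  simpa [corr, convolution_def] using integral_add_left_eq_self (fun y => k y * W (y - x)) x

lemma continuous_corr (hk : MemLp k ⊤ volume) (hW : Integrable W volume) :
    Continuous (corr k W) := by
  set M := lpNorm k ⊤ volume
  have hM0 : 0 ≤ M := lpNorm_nonneg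
  refine continuous_of_uniform_approx_of_continuous fun u hu => ?_
  obtain ⟨ε, hε, hεu⟩ := Metric.mem_uniformity_dist.1 hu
  obtain ⟨W', hc, hle, hcont, hint⟩ :=
    hW.exists_hasCompactSupport_integral_sub_le (ε := ε / (2 * (M + 1))) (by positivity)
  refine ⟨corr k W', continuous_corr_of_hasCompactSupport (hk.locallyIntegrable le_top) hcont hc,
    fun x => hεu ?_⟩
  have hsub : corr k W x - corr k W' x = corr k (W - W') x := by
    simp only [corr, Pi.sub_apply, mul_sub]
    exact (integral_sub (integrable_corr hk hW x) (integrable_corr hk hint x)).symm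
  calc dist (corr k W x) (corr k W' x) = |corr k (W - W') x| := by rw [Real.dist_eq, hsub]
    _ ≤ M * ∫ y, |W y - W' y| := abs_corr_le (ae_le_lpNorm_exponent_top hk) (hW.sub hint) x
    _ ≤ M * (ε / (2 * (M + 1))) := mul_le_mul_of_nonneg_left hle hM0
    _ = M / (M + 1) * (ε / 2) := by field_simp
    _ ≤ 1 * (ε / 2) := by gcongr; rw [div_le_one (by positivity)]; linarith
    _ < ε := by linarith

end Corr

lemma totalDegree_aeval_le {σ τ R S : Type*} [CommSemiring R] [CommSemiring S] [Algebra R S]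
    {f : σ → MvPolynomial τ S} (hf : ∀ i, (f i).totalDegree ≤ 1) (p : MvPolynomial σ R) :
    (MvPolynomial.aeval f p).totalDegree ≤ p.totalDegree := by
  rw [MvPolynomial.aeval_def, MvPolynomial.eval₂_eq]
  refine MvPolynomial.totalDegree_finsetSum_le fun d hd => ?_
  calc _ ≤ 0 + (∏ i ∈ d.support, f i ^ d i).totalDegree := by
        refine (MvPolynomial.totalDegree_mul _ _).trans_eq ?_
        rw [MvPolynomial.algebraMap_apply, MvPolynomial.totalDegree_C]
    _ ≤ ∑ i ∈ d.support, (f i ^ d i).totalDegree := by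
        rw [zero_add]
        exact MvPolynomial.totalDegree_finsetProd _ _
    _ ≤ ∑ i ∈ d.support, d i := Finset.sum_le_sum fun i _ =>
        (MvPolynomial.totalDegree_pow _ _).trans (by simpa using Nat.mul_le_mul_left (d i) (hf i))
    _ ≤ p.totalDegree := MvPolynomial.le_totalDegree hd

lemma continuous_of_mem_polyFun {r : ℕ} {f : E n → ℝ} (hf : f ∈ polyFun n r) : Continuous f := by
  obtain ⟨p, -, hfp⟩ := mem_polyFun_iff.1 hf
  rw [funext hfp]
  exact (MvPolynomial.continuous_eval p).comp (by fun_prop)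

lemma corr_mem_polyFun {r : ℕ} {f W : E n → ℝ} (hf : f ∈ polyFun n r) (hW : Integrable W volume)
    (hc : HasCompactSupport W) : corr f W ∈ polyFun n r := by
  obtain ⟨p, hp, hfp⟩ := mem_polyFun_iff.1 hf
  -- `p (x + y)` as a polynomial in `x` whose coefficients are polynomials in `y`
  let Q : MvPolynomial (Fin n) (MvPolynomial (Fin n) ℝ) :=
    MvPolynomial.aeval (fun a => MvPolynomial.X a + MvPolynomial.C (MvPolynomial.X a)) p
  have hQdeg : Q.totalDegree ≤ r := (totalDegree_aeval_le (fun a => by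
    exact (MvPolynomial.totalDegree_add _ _).trans (by simp)) p).trans hp
  have hQ (x y : E n) : f (x + y) = ∑ d ∈ Q.support,
      MvPolynomial.eval y (Q.coeff d) * ∏ a ∈ d.support, x a ^ d a := by
    rw [hfp, ← MvPolynomial.eval₂_eq, ← MvPolynomial.coe_eval₂Hom, MvPolynomial.map_aeval,
      MvPolynomial.eval]
    congr 2
    · ext; simp
    · ext; simp
  refine mem_polyFun_iff.2 ⟨∑ d ∈ Q.support, MvPolynomial.monomial d
    (∫ y : E n, MvPolynomial.eval y (Q.coeff d) * W y), ?_, fun x => ?_⟩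
  · exact MvPolynomial.totalDegree_finsetSum_le fun d hd =>
      (MvPolynomial.totalDegree_monomial_le _ _).trans
        ((MvPolynomial.le_totalDegree hd).trans hQdeg)
  · have hint (d : Fin n →₀ ℕ) :
        Integrable (fun y : E n => MvPolynomial.eval y (Q.coeff d) * W y) volume :=
      integrable_mul_of_hasCompactSupport (continuous_of_mem_polyFun
        (mem_polyFun_iff.2 ⟨Q.coeff d, le_rfl, fun _ => rfl⟩)) hW hc
    simp only [corr, hQ, Finset.sum_mul, mul_right_comm _ _ (W _)]
    rw [integral_finsetSum _ fun d _ => (hint d).mul_const _]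
    simp only [integral_mul_const, map_sum, MvPolynomial.eval_monomial, Finsupp.prod]

lemma MemSobolev.exists_polyFun_abs_corr_sub_le {U : Set (E n)} (hU : IsOpen U)
    (hconv : Convex ℝ U) (hb : Bornology.IsBounded U) {r : ℕ} {v W : E n → ℝ}
    (h : MemSobolev (r + 1) U v) (hW : Integrable W volume) (hc : HasCompactSupport W) :
    ∃ f ∈ polyFun n r, ∀ x, (∀ y, W y ≠ 0 → x + y ∈ U) → |corr (U.indicator v) W x - f x| ≤
      n ^ (r + 1) * Metric.diam U ^ (r + 1) * sobolevSeminorm (r + 1) U v * ∫ y, |W y| := by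
  obtain ⟨p, hp, hvp⟩ := h.exists_polyFun_ae_abs_sub_le hU hconv hb
  refine ⟨corr p W, corr_mem_polyFun hp hW hc, fun x hx => ?_⟩
  have hpc := continuous_of_mem_polyFun hp
  have hsub : corr (U.indicator v) W x - corr p W x = corr (U.indicator (v - p)) W x := by
    rw [corr, corr, ← integral_sub
      (integrable_corr ((memLp_indicator_iff_restrict hU.measurableSet).2 h.1) hW x)
      (integrable_mul_of_hasCompactSupport (k := fun y => p (x + y)) (by fun_prop) hW hc)]
    refine integral_congr_ae (Filter.Eventually.of_forall fun y => ?_)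
    by_cases hy : W y = 0
    · simp [hy]
    · simp [indicator_of_mem (hx y hy), sub_mul]
  rw [hsub]
  refine abs_corr_le ?_ hW x
  have hnonneg := sobolevSeminorm_nonneg (r + 1) U v
  filter_upwards [(ae_restrict_iff' hU.measurableSet).1 hvp] with z hz
  by_cases hzU : z ∈ U
  · rw [indicator_of_mem hzU]
    exact hz hzU
  · rw [indicator_of_notMem hzU, abs_zero]
    positivity

/-! ### Weights of stencil functions -/

/-- The weight with which the entry `(a, b)` of the tensor enters the stencil function of `φ` in
direction `δ`. -/
def stencilWeight (φ : E n → ℝ) (δ : E n) (a b : Fin n) (y : E n) : ℝ :=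
  gradient φ (y - δ) a * gradient φ y b

lemma measurable_gradient (f : E n → ℝ) : Measurable (gradient f) :=
  (LinearIsometryEquiv.continuous _).measurable.comp (measurable_fderiv ℝ f)

section Stencil

variable {φ : E n → ℝ} {L : ℝ≥0} {R : ℝ}

lemma measurable_stencilWeight (φ : E n → ℝ) (δ : E n) (a b : Fin n) :
    Measurable (stencilWeight φ δ a b) := by
  have hcoord (a : Fin n) : Measurable fun y => gradient φ y a :=
    (PiLp.continuous_apply 2 _ a).measurable.comp (measurable_gradient φ)
  exact ((hcoord a).comp (measurable_id.sub_const δ)).mul (hcoord b)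

lemma mem_overlap_of_stencilWeight_ne_zero (hφ : ∀ x, 0 ≤ φ x) {δ y : E n} {a b : Fin n}
    (hy : stencilWeight φ δ a b y ≠ 0) : y ∈ overlap φ δ := by
  constructor <;> refine fun h0 => hy ?_
  · simp [stencilWeight, gradient_eq_zero_of_nonneg hφ h0]
  · simp [stencilWeight, gradient_eq_zero_of_nonneg hφ (x := y - δ) h0]

lemma abs_stencilWeight_le (hL : LipschitzWith L φ) (δ : E n) (a b : Fin n) (y : E n) :
    |stencilWeight φ δ a b y| ≤ L ^ 2 := by
  have hgrad (y : E n) (a : Fin n) : |gradient φ y a| ≤ L := by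
    refine (PiLp.norm_apply_le (gradient φ y) a).trans ?_
    rw [gradient, LinearIsometryEquiv.norm_map]
    exact norm_fderiv_le_of_lipschitz ℝ hL
  rw [stencilWeight, abs_mul, sq]
  exact mul_le_mul (hgrad _ a) (hgrad _ b) (abs_nonneg _) L.coe_nonneg

lemma support_stencilWeight_subset (hφ : ∀ x, 0 ≤ φ x)
    (hR : Function.support φ ⊆ Metric.ball 0 R) (δ : E n) (a b : Fin n) :
    Function.support (stencilWeight φ δ a b) ⊆ Metric.ball 0 R :=
  fun _ hy => hR (mem_overlap_of_stencilWeight_ne_zero hφ hy).1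

lemma hasCompactSupport_stencilWeight (hφ : ∀ x, 0 ≤ φ x)
    (hR : Function.support φ ⊆ Metric.ball 0 R) (δ : E n) (a b : Fin n) :
    HasCompactSupport (stencilWeight φ δ a b) :=
  .of_support_subset_isCompact (isCompact_closedBall 0 R)
    ((support_stencilWeight_subset hφ hR δ a b).trans Metric.ball_subset_closedBall)

lemma integrable_stencilWeight (hφ : ∀ x, 0 ≤ φ x) (hL : LipschitzWith L φ)
    (hR : Function.support φ ⊆ Metric.ball 0 R) (δ : E n) (a b : Fin n) :
    Integrable (stencilWeight φ δ a b) volume := by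
  rw [← integrableOn_iff_integrable_of_support_subset (support_stencilWeight_subset hφ hR δ a b)]
  exact Measure.integrableOn_of_bounded measure_ball_lt_top.ne
    (measurable_stencilWeight φ δ a b).aestronglyMeasurable
    (Filter.Eventually.of_forall (abs_stencilWeight_le hL δ a b))

lemma integral_abs_stencilWeight_le (hφ : ∀ x, 0 ≤ φ x) (hL : LipschitzWith L φ)
    (hR : Function.support φ ⊆ Metric.ball 0 R) (δ : E n) (a b : Fin n) :
    ∫ y, |stencilWeight φ δ a b y| ≤ L ^ 2 * volume.real (Metric.ball (0 : E n) R) := by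
  rw [← setIntegral_eq_integral_of_forall_compl_eq_zero (s := Metric.ball 0 R) fun y hy =>
    abs_eq_zero.2 (of_not_not fun hne => hy (support_stencilWeight_subset hφ hR δ a b hne))]
  refine (Real.le_norm_self _).trans (norm_setIntegral_le_of_norm_le_const measure_ball_lt_top
    fun y _ => ?_)
  rw [Real.norm_eq_abs, abs_abs]
  exact abs_stencilWeight_le hL δ a b y

/-! ### Approximation of stencil functions -/

variable {U : Set (E n)} {K : E n → Matrix (Fin n) (Fin n) ℝ} {δ x : E n}

lemma stencilFn_eq_sum_corr (hφ : ∀ x, 0 ≤ φ x) (hL : LipschitzWith L φ)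
    (hR : Function.support φ ⊆ Metric.ball 0 R) (hU : MeasurableSet U)
    (hK : ∀ a b, MemLp (fun x => K x a b) ⊤ (volume.restrict U))
    (hx : ∀ y ∈ overlap φ δ, x + y ∈ U) :
    stencilFn K φ δ x =
      ∑ a, ∑ b, corr (U.indicator fun y => K y a b) (stencilWeight φ δ a b) x := by
  have hint (a b : Fin n) : Integrable (fun y => U.indicator (fun y => K y a b) (x + y) *
      stencilWeight φ δ a b y) volume :=
    integrable_corr ((memLp_indicator_iff_restrict hU).2 (hK a b))
      (integrable_stencilWeight hφ hL hR δ a b) x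
  simp only [corr]
  simp_rw [← integral_finsetSum _ fun b _ => hint _ b]
  rw [← integral_finsetSum _ fun a _ => integrable_finsetSum _ fun b _ => hint a b,
    stencilFn_eq_integral hφ]
  refine integral_congr_ae (Filter.Eventually.of_forall fun y => ?_)
  refine Finset.sum_congr rfl fun a _ => Finset.sum_congr rfl fun b _ => ?_
  rw [mul_right_comm, mul_comm, ← stencilWeight]
  by_cases hy : stencilWeight φ δ a b y = 0
  · simp [hy]
  · rw [indicator_of_mem (hx y (mem_overlap_of_stencilWeight_ne_zero hφ hy))]

lemma continuousOn_stencilFn (hφ : ∀ x, 0 ≤ φ x) (hL : LipschitzWith L φ)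
    (hR : Function.support φ ⊆ Metric.ball 0 R) (hU : MeasurableSet U)
    (hK : ∀ a b, MemLp (fun x => K x a b) ⊤ (volume.restrict U)) {S : Set (E n)}
    (hS : ∀ x ∈ S, ∀ y ∈ overlap φ δ, x + y ∈ U) : ContinuousOn (stencilFn K φ δ) S := by
  refine ContinuousOn.congr ?_ fun x hx => stencilFn_eq_sum_corr hφ hL hR hU hK (hS x hx)
  exact (continuous_finsetSum _ fun a _ => continuous_finsetSum _ fun b _ =>
    continuous_corr ((memLp_indicator_iff_restrict hU).2 (hK a b))
      (integrable_stencilWeight hφ hL hR δ a b)).continuousOn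

lemma sobolevSeminorm_le_tensorSeminorm (k : ℕ) (U : Set (E n))
    (K : E n → Matrix (Fin n) (Fin n) ℝ) (a b : Fin n) :
    sobolevSeminorm k U (fun x => K x a b) ≤ tensorSeminorm k U K :=
  (le_ciSup (f := fun b => sobolevSeminorm k U fun x => K x a b) (finite_range _).bddAbove b).trans
    (le_ciSup (f := fun a => ⨆ b, sobolevSeminorm k U fun x => K x a b) (finite_range _).bddAbove a)

lemma tensorSeminorm_nonneg (k : ℕ) (U : Set (E n)) (K : E n → Matrix (Fin n) (Fin n) ℝ) :
    0 ≤ tensorSeminorm k U K :=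
  Real.iSup_nonneg fun _ => Real.iSup_nonneg fun _ => sobolevSeminorm_nonneg _ _ _

lemma exists_polyFun_abs_stencilFn_sub_le (hφ : ∀ x, 0 ≤ φ x) (hL : LipschitzWith L φ)
    (hR : Function.support φ ⊆ Metric.ball 0 R) (hU : IsOpen U) (hconv : Convex ℝ U)
    (hb : Bornology.IsBounded U) {r : ℕ} (hK : ∀ a b, MemSobolev (r + 1) U fun x => K x a b)
    (δ : E n) :
    ∃ f ∈ polyFun n r, ∀ x, (∀ y ∈ overlap φ δ, x + y ∈ U) → |stencilFn K φ δ x - f x| ≤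
      n ^ 2 * (n ^ (r + 1) * Metric.diam U ^ (r + 1) * tensorSeminorm (r + 1) U K *
        (L ^ 2 * volume.real (Metric.ball (0 : E n) R))) := by
  choose f hf hfb using fun a b => (hK a b).exists_polyFun_abs_corr_sub_le hU hconv hb
    (integrable_stencilWeight hφ hL hR δ a b) (hasCompactSupport_stencilWeight hφ hR δ a b)
  refine ⟨∑ a, ∑ b, f a b, Submodule.sum_mem _ fun a _ => Submodule.sum_mem _ fun b _ => hf a b,
    fun x hx => ?_⟩
  rw [stencilFn_eq_sum_corr hφ hL hR hU.measurableSet (fun a b => (hK a b).1) hx]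
  simp only [Finset.sum_apply, ← Finset.sum_sub_distrib]
  set B := n ^ (r + 1) * Metric.diam U ^ (r + 1) * tensorSeminorm (r + 1) U K *
    (L ^ 2 * volume.real (Metric.ball (0 : E n) R))
  have hB (a b : Fin n) :
      |corr (U.indicator fun y => K y a b) (stencilWeight φ δ a b) x - f a b x| ≤ B := by
    refine (hfb a b x fun y hy =>
      hx y (mem_overlap_of_stencilWeight_ne_zero hφ hy)).trans ?_
    have hnonneg := tensorSeminorm_nonneg (r + 1) U K
    exact mul_le_mul (mul_le_mul_of_nonneg_left
        (sobolevSeminorm_le_tensorSeminorm (r + 1) U K a b) (by positivity))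
      (integral_abs_stencilWeight_le hφ hL hR δ a b)
      (integral_nonneg fun _ => abs_nonneg _) (by positivity)
  calc _ ≤ ∑ a, ∑ b,
        |corr (U.indicator fun y => K y a b) (stencilWeight φ δ a b) x - f a b x| :=
        (Finset.abs_sum_le_sum_abs _ _).trans
          (Finset.sum_le_sum fun a _ => Finset.abs_sum_le_sum_abs _ _)
    _ ≤ ∑ _a : Fin n, ∑ _b : Fin n, B :=
        Finset.sum_le_sum fun a _ => Finset.sum_le_sum fun b _ => hB a b
    _ = n ^ 2 * B := by simp [sq, mul_assoc]

end Stencil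

lemma abs_sub_project_le {S : Set (E n)} {q : ℕ} {Λ : ℝ} {P : C(S, ℝ) →ₗ[ℝ] C(S, ℝ)}
    (hP : IsPolyProjection q Λ P) {f g : E n → ℝ} (hf : ContinuousOn f S) (hg : g ∈ polyFun n q)
    {B : ℝ} (hB : ∀ x ∈ S, |f x - g x| ≤ B) {x : E n} (hx : x ∈ S) :
    |f x - project P f x| ≤ (1 + Λ) * B := by
  let F : C(S, ℝ) := ⟨S.domRestrict f, hf.domRestrict⟩
  let G : C(S, ℝ) := ⟨fun x => g x, (continuous_of_mem_polyFun hg).comp continuous_subtype_val⟩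
  have hPG : P G = G := hP.fix G <|
    let ⟨p, hp, hgp⟩ := mem_polyFun_iff.1 hg
    ⟨p, hp, fun y => hgp y⟩
  have hproject : project P f x = P F ⟨x, hx⟩ := by rw [project, dif_pos hf, dif_pos hx]
  have hbound : |g x - project P f x| ≤ Λ * B := by
    have := hP.bound (F - G) B (fun y => hB y y.2) ⟨x, hx⟩
    rw [map_sub, hPG] at this
    rw [hproject, abs_sub_comm]
    exact this
  calc |f x - project P f x| ≤ |f x - g x| + |g x - project P f x| := abs_sub_le _ _ _
    _ ≤ B + Λ * B := add_le_add (hB x hx) hbound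
    _ = (1 + Λ) * B := by ring

lemma abs_stencilFn_sub_project_le (hn : n ≠ 0) {T : Macro n} {φ : E n → ℝ} {L : ℝ≥0} {R : ℝ}
    (hφ : ∀ x, 0 ≤ φ x) (hL : LipschitzWith L φ) (hR : Function.support φ ⊆ Metric.ball 0 R)
    {q r : ℕ} (hr : r ≤ q) {K : E n → Matrix (Fin n) (Fin n) ℝ}
    (hK : ∀ a b, MemSobolev (r + 1) T.interior fun x => K x a b) {Λ : ℝ} {δ : E n}
    {P : C(stencilDomain T φ δ, ℝ) →ₗ[ℝ] C(stencilDomain T φ δ, ℝ)} (hP : IsPolyProjection q Λ P)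
    {x : E n} (hx : x ∈ stencilDomain T φ δ) :
    |stencilFn K φ δ x - project P (stencilFn K φ δ) x| ≤
      (1 + Λ) * (n ^ 2 * (n ^ (r + 1) * elemDiam T ^ (r + 1) * tensorSeminorm (r + 1) T.interior K *
        (L ^ 2 * volume.real (Metric.ball (0 : E n) R)))) := by
  have hT := isOpen_interior_simplex hn T
  have hdiam : Metric.diam T.interior = elemDiam T := by
    rw [elemDiam, ← closure_interior_simplex hn, Metric.diam_closure]
  have hdom (x) (hx : x ∈ stencilDomain T φ δ) (y) (hy : y ∈ overlap φ δ) : x + y ∈ T.interior :=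
    add_mem_interior_of_mem_stencilDomain hn hL.continuous hx hy
  obtain ⟨f, hf, hfb⟩ := exists_polyFun_abs_stencilFn_sub_le hφ hL hR hT
    (convex_interior_simplex hn T)
    (T.isCompact_closedInterior.isBounded.subset T.interior_subset_closedInterior) hK δ
  rw [hdiam] at hfb
  exact abs_sub_project_le hP
    (continuousOn_stencilFn hφ hL hR hT.measurableSet (fun a b => (hK a b).1) hdom)
    (polyFun_mono hr hf) (fun x hx => hfb x (hdom x hx)) hx

/-! ### The error estimate -/

lemma lipschitzWith_hatFn {T : Macro n} {z : E n} {ρ : ℝ} (hρ : 0 < ρ)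
    (h : Metric.closedBall z ρ ⊆ T.closedInterior) (m : ℕ) :
    LipschitzWith (2 ^ m * (2 * (n + 1) / ρ)).toNNReal (hatFn m T) := by
  refine LipschitzWith.of_dist_le_mul fun v w => ?_
  rw [Real.coe_toNNReal _ (by positivity), Real.dist_eq, dist_eq_norm]
  calc |hatFn m T v - hatFn m T w|
      ≤ |(1 - 2 ^ m * wallSeminorm T v) - (1 - 2 ^ m * wallSeminorm T w)| :=
        (abs_max_sub_max_le_max 0 _ 0 _).trans (by simp)
    _ = 2 ^ m * |wallSeminorm T v - wallSeminorm T w| := by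
        rw [sub_sub_sub_cancel_left, ← mul_sub, abs_mul, abs_sub_comm, abs_of_pos (by positivity)]
    _ ≤ 2 ^ m * wallSeminorm T (v - w) := by
        gcongr
        exact abs_sub_map_le_sub _ v w
    _ ≤ 2 ^ m * (2 * (n + 1) * (‖v - w‖ / ρ)) := by
        gcongr
        exact wallSeminorm_le_of_abs_baryDir_le (abs_baryDir_le_of_closedBall_subset hρ h · (v - w))
    _ = 2 ^ m * (2 * (n + 1) / ρ) * ‖v - w‖ := by ring

lemma support_hatFn_subset_ball {T : Macro n} (hT : 0 < elemDiam T) (m : ℕ) :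
    Function.support (hatFn m T) ⊆ Metric.ball 0 ((n + 1) * (elemDiam T / 2 ^ m)) := by
  intro v hv
  have hwall : wallSeminorm T v < 1 / 2 ^ m := by
    rw [lt_div_iff₀' (by positivity)]
    exact hatFn_ne_zero_iff.1 hv
  rw [mem_ball_zero_iff]
  calc ‖v‖ ≤ (n + 1) * elemDiam T * wallSeminorm T v := norm_le_wallSeminorm T v
    _ < (n + 1) * elemDiam T * (1 / 2 ^ m) := mul_lt_mul_of_pos_left hwall (by positivity)
    _ = (n + 1) * (elemDiam T / 2 ^ m) := by ring

lemma sq_div_mul_measureReal_ball (hn : 2 ≤ n) {h R : ℝ} (hh : 0 < h) (hR : 0 < R) (c : ℝ) :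
    (c / h) ^ 2 * volume.real (Metric.ball (0 : E n) (R * h)) =
      c ^ 2 * R ^ n * volume.real (Metric.ball (0 : E n) 1) * h ^ (n - 2) := by
  have hball : volume.real (Metric.ball (0 : E n) (R * h)) =
      (R * h) ^ n * volume.real (Metric.ball (0 : E n) 1) := by
    rw [measureReal_def, measureReal_def, Measure.addHaar_ball_of_pos _ _ (by positivity),
      ENNReal.toReal_mul, ENNReal.toReal_ofReal (by positivity), finrank_euclideanSpace_fin]
  obtain ⟨k, rfl⟩ := Nat.exists_eq_add_of_le hn
  rw [hball, Nat.add_sub_cancel_left, mul_pow R, pow_add h]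
  field_simp

/-- The constant of the error estimate. The last summand keeps it positive for every `σ`. -/
def errorConst (n q : ℕ) (σ Λ : ℝ) : ℝ :=
  (1 + |Λ|) * (n ^ 2 * n ^ (q + 1) *
    ((2 * (n + 1) * σ) ^ 2 * (n + 1) ^ n * volume.real (Metric.ball (0 : E n) 1))) + 1

lemma errorConst_pos (n q : ℕ) (σ Λ : ℝ) : 0 < errorConst n q σ Λ := by
  unfold errorConst
  positivity

lemma stencil_bound_le_errorConst_mul (hn : 2 ≤ n) {q r : ℕ} (hr : r ≤ q) (m : ℕ)
    {T : Macro n} {ρ σ : ℝ} (hρ : 0 < ρ) (hσ : elemDiam T ≤ σ * ρ) (Λ : ℝ)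
    (K : E n → Matrix (Fin n) (Fin n) ℝ) :
    (1 + Λ) * (n ^ 2 * (n ^ (r + 1) * elemDiam T ^ (r + 1) * tensorSeminorm (r + 1) T.interior K *
      ((2 ^ m * (2 * (n + 1) / ρ)) ^ 2 *
        volume.real (Metric.ball (0 : E n) ((n + 1) * (elemDiam T / 2 ^ m)))))) ≤
      errorConst n q σ Λ * (elemDiam T / 2 ^ m) ^ (n - 2) * elemDiam T ^ (r + 1) *
        tensorSeminorm (r + 1) T.interior K := by
  have hH : 0 < elemDiam T := elemDiam_pos (by omega) T
  have hS := tensorSeminorm_nonneg (r + 1) T.interior K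
  set H := elemDiam T
  set S := tensorSeminorm (r + 1) T.interior K
  set V := volume.real (Metric.ball (0 : E n) 1)
  have hgrad : 2 ^ m * (2 * ((n : ℝ) + 1) / ρ) ≤ 2 * (n + 1) * σ / (H / 2 ^ m) := by
    have hinv : 1 / ρ ≤ σ / H := by rwa [div_le_div_iff₀ hρ hH, one_mul]
    calc 2 ^ m * (2 * ((n : ℝ) + 1) / ρ) = 2 ^ m * (2 * (n + 1)) * (1 / ρ) := by ring
      _ ≤ 2 ^ m * (2 * (n + 1)) * (σ / H) := by gcongr
      _ = _ := by field_simp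
  have hpow : (n : ℝ) ^ (r + 1) ≤ n ^ (q + 1) :=
    pow_le_pow_right₀ (by exact_mod_cast (by omega : 1 ≤ n)) (by omega)
  calc _ ≤ (1 + |Λ|) * (n ^ 2 * (n ^ (q + 1) * H ^ (r + 1) * S *
        ((2 * (n + 1) * σ / (H / 2 ^ m)) ^ 2 *
          volume.real (Metric.ball (0 : E n) ((n + 1) * (H / 2 ^ m)))))) := by
        gcongr
        exact le_abs_self Λ
    _ = (errorConst n q σ Λ - 1) * (H / 2 ^ m) ^ (n - 2) * H ^ (r + 1) * S := by
        rw [sq_div_mul_measureReal_ball hn (by positivity) (by positivity), errorConst]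
        ring
    _ ≤ errorConst n q σ Λ * (H / 2 ^ m) ^ (n - 2) * H ^ (r + 1) * S := by
        gcongr
        linarith

lemma maxNormOn_le {V S : Set (E n)} {M : Matrix V V ℝ} {B : ℝ} (hB : 0 ≤ B)
    (h : ∀ i j : V, i.1 ∈ S → j.1 ∈ S → |M i j| ≤ B) : maxNormOn S M ≤ B := by
  refine Real.sSup_le ?_ hB
  rintro _ ⟨i, j, hi, hj, rfl⟩
  exact h i j hi hj

section Error

variable {Ω : Set (E n)} {Th : Set (Macro n)} {m q r : ℕ} {σ Λ : ℝ} {c : Macro n → E n}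
  {P : ProjectionFamily Th m c} {K : E n → Matrix (Fin n) (Fin n) ℝ}

lemma abs_stencilFn_sub_surrogateStencilFn_le (hn : n = 2 ∨ n = 3) (h : IsMacroMesh Ω Th)
    (hσ : ShapeRegular σ Th) {T : Macro n} (hT : T ∈ Th) (hc : c T ∈ latticeInterior m T)
    {δ x : E n} (hP : IsPolyProjection q Λ (P T δ)) (hr : r ≤ q)
    (hK : ∀ a b, MemSobolev (r + 1) T.interior fun x => K x a b)
    (hx : x ∈ stencilDomain T (hatFn m T) δ) :
    |stencilFn K (hatFn m T) δ x - surrogateStencilFn Th m K c P T δ x| ≤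
      errorConst n q σ Λ * (elemDiam T / 2 ^ m) ^ (n - 2) * elemDiam T ^ (r + 1) *
        tensorSeminorm (r + 1) T.interior K := by
  have hn0 : n ≠ 0 := by omega
  obtain ⟨z, ρ, hρ, hball, hHρ⟩ := hσ T hT
  have hnonneg := hatFn_nonneg m T
  have hLip := lipschitzWith_hatFn hρ hball m
  have hsupp := support_hatFn_subset_ball (elemDiam_pos hn0 T) m
  rw [← testFn_eq_hatFn hn h hT hc] at hx hnonneg hLip hsupp ⊢
  refine (abs_stencilFn_sub_project_le hn0 hnonneg hLip hsupp hr hK hP hx).trans ?_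
  rw [Real.coe_toNNReal _ (by positivity)]
  exact stencil_bound_le_errorConst_mul (by omega) hr m hρ hHρ Λ K

lemma trueMatrix_sub_surrogateMatrix_eq_zero_or_abs_le (hn : n = 2 ∨ n = 3)
    (h : IsMacroMesh Ω Th) (hσ : ShapeRegular σ Th)
    (hc : ∀ T ∈ Th, (latticeInterior m T).Nonempty → c T ∈ latticeInterior m T)
    (hP : ∀ T ∈ Th, ∀ δ ∈ translations Th m T, IsPolyProjection q Λ (P T δ)) (hr : r ≤ q)
    (K : E n → Matrix (Fin n) (Fin n) ℝ) (i j : vertices Th m) :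
    (trueMatrix Ω Th m K - surrogateMatrix Ω Th m K c P) i j = 0 ∨
      ∃ T ∈ Th, (i.1 ∈ latticeInterior m T ∨ j.1 ∈ latticeInterior m T) ∧
        ((∀ a b, MemSobolev (r + 1) T.interior fun x => K x a b) →
          |(trueMatrix Ω Th m K - surrogateMatrix Ω Th m K c P) i j| ≤
            errorConst n q σ Λ * (elemDiam T / 2 ^ m) ^ (n - 2) * elemDiam T ^ (r + 1) *
              tensorSeminorm (r + 1) T.interior K) := by
  refine (trueMatrix_sub_surrogateMatrix hn h K c P i j).imp_right ?_
  rintro ⟨T, hT, hij, hi, hδ, herror⟩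
  refine ⟨T, hT, hij, fun hK => ?_⟩
  have hcT : c T ∈ latticeInterior m T := hc T hT (hij.elim (⟨_, ·⟩) (⟨_, ·⟩))
  rw [herror]
  exact abs_stencilFn_sub_surrogateStencilFn_le hn h hσ hT hcT (hP T hT _ hδ) hr hK
    (mem_stencilDomain (by omega) (by rwa [add_sub_cancel]) hi hcT)

lemma maxNormOn_lattice_error_le (hn : n = 2 ∨ n = 3) (h : IsMacroMesh Ω Th)
    (hσ : ShapeRegular σ Th)
    (hc : ∀ T ∈ Th, (latticeInterior m T).Nonempty → c T ∈ latticeInterior m T)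
    (hP : ∀ T ∈ Th, ∀ δ ∈ translations Th m T, IsPolyProjection q Λ (P T δ)) (hr : r ≤ q)
    {T : Macro n} (hT : T ∈ Th) (hK : ∀ a b, MemSobolev (r + 1) T.interior fun x => K x a b) :
    maxNormOn (lattice m T) (trueMatrix Ω Th m K - surrogateMatrix Ω Th m K c P) ≤
      errorConst n q σ Λ * (elemDiam T / 2 ^ m) ^ (n - 2) * elemDiam T ^ (r + 1) *
        tensorSeminorm (r + 1) T.interior K := by
  have hn0 : n ≠ 0 := by omega
  have hC := errorConst_pos n q σ Λ
  have hH := elemDiam_pos hn0 T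
  have hS := tensorSeminorm_nonneg (r + 1) T.interior K
  refine maxNormOn_le (by positivity) fun i j hi hj => ?_
  rcases trueMatrix_sub_surrogateMatrix_eq_zero_or_abs_le hn h hσ hc hP hr K i j with
    hzero | ⟨T', hT', hij, hle⟩
  · rw [hzero, abs_zero]
    positivity
  · have heq : T = T' := hij.elim
      (fun hi' => h.eq_of_mem_interior hn0 hT' hT hi'.2 (lattice_subset_closedInterior m T hi))
      (fun hj' => h.eq_of_mem_interior hn0 hT' hT hj'.2 (lattice_subset_closedInterior m T hj))
    subst heq
    exact hle hK

lemma maxNorm_error_le (hn : n = 2 ∨ n = 3) (h : IsMacroMesh Ω Th) (hσ : ShapeRegular σ Th)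
    (hc : ∀ T ∈ Th, (latticeInterior m T).Nonempty → c T ∈ latticeInterior m T)
    (hP : ∀ T ∈ Th, ∀ δ ∈ translations Th m T, IsPolyProjection q Λ (P T δ)) (hr : r ≤ q)
    (hK : ∀ T ∈ Th, ∀ a b, MemSobolev (r + 1) T.interior fun x => K x a b) :
    maxNorm (trueMatrix Ω Th m K - surrogateMatrix Ω Th m K c P) ≤
      errorConst n q σ Λ * (meshSize Th / 2 ^ m) ^ (n - 2) * meshSize Th ^ (r + 1) *
        ⨆ T : Th, tensorSeminorm (r + 1) T.1.interior K := by
  have : Finite Th := h.finite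
  have hC := errorConst_pos n q σ Λ
  have hmesh : 0 ≤ meshSize Th := Real.iSup_nonneg fun T => Metric.diam_nonneg
  have hsup : 0 ≤ ⨆ T : Th, tensorSeminorm (r + 1) T.1.interior K :=
    Real.iSup_nonneg fun T => tensorSeminorm_nonneg _ _ _
  refine maxNormOn_le (by positivity) fun i j _ _ => ?_
  rcases trueMatrix_sub_surrogateMatrix_eq_zero_or_abs_le hn h hσ hc hP hr K i j with
    hzero | ⟨T, hT, -, hle⟩
  · rw [hzero, abs_zero]
    positivity
  · have hH := elemDiam_pos (by omega) T
    have hS := tensorSeminorm_nonneg (r + 1) T.interior K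
    have hHle : elemDiam T ≤ meshSize Th :=
      le_ciSup (f := fun T : Th => elemDiam T.1) (finite_range _).bddAbove ⟨T, hT⟩
    have hSle : tensorSeminorm (r + 1) T.interior K ≤
        ⨆ T : Th, tensorSeminorm (r + 1) T.1.interior K :=
      le_ciSup (f := fun T : Th => tensorSeminorm (r + 1) T.1.interior K)
        (finite_range _).bddAbove ⟨T, hT⟩
    refine (hle (hK T hT)).trans ?_
    gcongr

end Error

end SurrogateFEM

end

theorem mainTheorem3 (n : ℕ) (hn : n = 2 ∨ n = 3) (q : ℕ) (σ Λ : ℝ) :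
    ∃ C : ℝ, 0 < C ∧
      ∀ (Ω : Set (SurrogateFEM.E n)) (Th : Set (SurrogateFEM.Macro n)) (m : ℕ)
        (c : SurrogateFEM.Macro n → SurrogateFEM.E n)
        (P : SurrogateFEM.ProjectionFamily Th m c)
        (K : SurrogateFEM.E n → Matrix (Fin n) (Fin n) ℝ) (r : ℕ),
        SurrogateFEM.IsMacroMesh Ω Th →
        SurrogateFEM.ShapeRegular σ Th →
        (∀ T ∈ Th, (SurrogateFEM.latticeInterior m T).Nonempty →
          c T ∈ SurrogateFEM.latticeInterior m T) →
        (∀ T ∈ Th, ∀ δ ∈ SurrogateFEM.translations Th m T,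
          SurrogateFEM.IsPolyProjection q Λ (P T δ)) →
        r ≤ q →
        (∀ T ∈ Th,
          (∀ a b, SurrogateFEM.MemSobolev (r + 1) T.interior (fun x => K x a b)) →
          SurrogateFEM.maxNormOn (SurrogateFEM.lattice m T)
              (SurrogateFEM.trueMatrix Ω Th m K - SurrogateFEM.surrogateMatrix Ω Th m K c P) ≤
            C * (SurrogateFEM.elemDiam T / 2 ^ m) ^ (n - 2) * SurrogateFEM.elemDiam T ^ (r + 1) *
              SurrogateFEM.tensorSeminorm (r + 1) T.interior K) ∧
        ((∀ T ∈ Th, ∀ a b, SurrogateFEM.MemSobolev (r + 1) T.interior (fun x => K x a b)) →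
          SurrogateFEM.maxNorm
              (SurrogateFEM.trueMatrix Ω Th m K - SurrogateFEM.surrogateMatrix Ω Th m K c P) ≤
            C * (SurrogateFEM.meshSize Th / 2 ^ m) ^ (n - 2) *
              SurrogateFEM.meshSize Th ^ (r + 1) *
              ⨆ T : Th, SurrogateFEM.tensorSeminorm (r + 1) T.1.interior K) := by
  refine ⟨SurrogateFEM.errorConst n q σ Λ, SurrogateFEM.errorConst_pos n q σ Λ, ?_⟩
  intro Ω Th m c P K r hTh hσ hc hP hr
  exact ⟨fun T hT hK => SurrogateFEM.maxNormOn_lattice_error_le hn hTh hσ hc hP hr hT hK,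
    fun hK => SurrogateFEM.maxNorm_error_le hn hTh hσ hc hP hr hK⟩
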